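/- Let $\Omega=(0,1)^{\mathbb Z}$ carry the product topology and $\sigma$-algebra, and let $\mathbb P$ be a probability measure on $\Omega$ (with expectation $\mathbb E$) that is stationary and ergodic with respect to the shift $(\theta\omega)_x=\omega_{x+1}$. For $\omega=(\omega_x^+)_{x\in\mathbb Z}\in\Omega$ put $\omega_x^-:=1-\omega_x^+$ and $\rho_x:=\omega_x^- /\omega_x^+$, and assume that $\mathbb E[\log\rho_0]$ is well defined, with $\pm\infty$ as possible values (that is, the positive or the negative part of $\log\rho_0$ has finite expectation). For $\lambda\in\mathbb R$ let $P_0^{\omega,\lambda}$ be the law of the discrete-time random walk $(X_n)_{n\ge 0}$ on $\mathbb Z$ that starts at $0$ and jumps from $x$ to $x\pm1$ with probability $$\omega_x^\pm(\lambda)=\frac{\omega_x^\pm e^{\pm\lambda}}{\omega_x^-e^{-\lambda}+\omega_x^+e^{\lambda}}.$$ Then, for every $\lambda\in\mathbb R$, there is a deterministic number $v_X(\lambda)\in\mathbb R$ such that $X_n/n\to v_X(\lambda)$ as $n\to\infty$, for $\mathbb P$-almost every $\omega$ and $P_0^{\omega,\lambda}$-almost surely. Define, in $[-\infty,+\infty]$,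 $$\lambda_-:=\sup\{\lambda\in\mathbb R: v_X(\lambda)<0\},\qquad \lambda_+:=\inf\{\lambda\in\mathbb R: v_X(\lambda)>0\},$$ with $\sup\emptyset=-\infty$ and $\inf\emptyset=+\infty$. If $\lambda_-=\lambda_+$, then $v_X$ is continuous on all of $\mathbb R$; moreover $$\lambda_-=\lambda_+=\tfrac12\,\mathbb E[\log\rho_0]\in[-\infty,+\infty],$$ and, if this common value is finite, $v_X(\lambda_-)=v_X(\lambda_+)=0$. -/

import Mathlib

open MeasureTheory ProbabilityTheory Filter Topology

namespace RWRE

/-- The space of environments `(0,1)^ℤ`, with the product topology and the product sigma-algebra.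
The coordinate `ω x` is the probability `ω_x^+` of a jump from `x` to `x + 1`. -/
abbrev Env : Type := ℤ → Set.Ioo (0 : ℝ) 1

/-- The shift `(θ ω)_x = ω_{x+1}` on environments. -/
def shift (ω : Env) : Env := fun x => ω (x + 1)

/-- `ω_x^+`. -/
def pPlus (ω : Env) (x : ℤ) : ℝ := (ω x : ℝ)

/-- `ω_x^- = 1 - ω_x^+`. -/
def pMinus (ω : Env) (x : ℤ) : ℝ := 1 - (ω x : ℝ)

/-- `ρ_x = ω_x^- / ω_x^+`. -/
noncomputable def rho (ω : Env) (x : ℤ) : ℝ := pMinus ω x / pPlus ω x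

/-- The biased jump probability to the right, `ω_x^+(λ)`. -/
noncomputable def biasedPlus (lam : ℝ) (ω : Env) (x : ℤ) : ℝ :=
  pPlus ω x * Real.exp lam / (pMinus ω x * Real.exp (-lam) + pPlus ω x * Real.exp lam)

/-- The biased jump probability to the left, `ω_x^-(λ)`. -/
noncomputable def biasedMinus (lam : ℝ) (ω : Env) (x : ℤ) : ℝ :=
  pMinus ω x * Real.exp (-lam) / (pMinus ω x * Real.exp (-lam) + pPlus ω x * Real.exp lam)

theorem pPlus_pos (ω : Env) (x : ℤ) : 0 < pPlus ω x := (ω x).2.1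

theorem pMinus_pos (ω : Env) (x : ℤ) : 0 < pMinus ω x := sub_pos.2 (ω x).2.2

theorem biased_denom_pos (lam : ℝ) (ω : Env) (x : ℤ) :
    0 < pMinus ω x * Real.exp (-lam) + pPlus ω x * Real.exp lam := by
  have h1 := pPlus_pos ω x
  have h2 := pMinus_pos ω x
  positivity

theorem biasedPlus_nonneg (lam : ℝ) (ω : Env) (x : ℤ) : 0 ≤ biasedPlus lam ω x :=
  div_nonneg (mul_nonneg (pPlus_pos ω x).le (Real.exp_pos _).le) (biased_denom_pos lam ω x).le

theorem biasedMinus_nonneg (lam : ℝ) (ω : Env) (x : ℤ) : 0 ≤ biasedMinus lam ω x :=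
  div_nonneg (mul_nonneg (pMinus_pos ω x).le (Real.exp_pos _).le) (biased_denom_pos lam ω x).le

theorem biasedPlus_add_biasedMinus (lam : ℝ) (ω : Env) (x : ℤ) :
    biasedPlus lam ω x + biasedMinus lam ω x = 1 := by
  unfold biasedPlus biasedMinus
  rw [← add_div, add_comm, div_self (biased_denom_pos lam ω x).ne']

/-- The law of the position after one jump of the biased walk from the site `x`: it is `x + 1` with
probability `ω_x^+(λ)` and `x - 1` with probability `ω_x^-(λ)`. -/
noncomputable def stepLaw (lam : ℝ) (ω : Env) (x : ℤ) : Measure ℤ :=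
  ENNReal.ofReal (biasedPlus lam ω x) • Measure.dirac (x + 1)
    + ENNReal.ofReal (biasedMinus lam ω x) • Measure.dirac (x - 1)

instance stepLaw_isProbabilityMeasure (lam : ℝ) (ω : Env) (x : ℤ) :
    IsProbabilityMeasure (stepLaw lam ω x) := by
  constructor
  simp only [stepLaw, Measure.coe_add, Measure.coe_smul, Pi.add_apply, Pi.smul_apply,
    measure_univ, smul_eq_mul, mul_one]
  rw [← ENNReal.ofReal_add (biasedPlus_nonneg lam ω x) (biasedMinus_nonneg lam ω x),
    biasedPlus_add_biasedMinus, ENNReal.ofReal_one]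

/-- The transition kernel of the biased walk: given the trajectory up to time `n`, the position at
time `n + 1` is drawn from `stepLaw` at the position at time `n`. -/
noncomputable def walkKernel (lam : ℝ) (ω : Env) (n : ℕ) :
    Kernel ((i : Finset.Iic n) → (fun _ : ℕ => ℤ) i) ℤ where
  toFun h := stepLaw lam ω (h ⟨n, Finset.mem_Iic.2 le_rfl⟩)
  measurable' := (measurable_of_countable (stepLaw lam ω)).comp
    (measurable_pi_apply (⟨n, Finset.mem_Iic.2 le_rfl⟩ : Finset.Iic n))

instance walkKernel_isMarkovKernel (lam : ℝ) (ω : Env) (n : ℕ) :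
    IsMarkovKernel (walkKernel lam ω n) :=
  ⟨fun h => stepLaw_isProbabilityMeasure lam ω (h ⟨n, Finset.mem_Iic.2 le_rfl⟩)⟩

/-- The quenched law `P_0^{ω,λ}`: the law on trajectories `ℕ → ℤ` of the biased walk in the
environment `ω` that starts at the origin at time `0`. -/
noncomputable def walkLaw (lam : ℝ) (ω : Env) : Measure (ℕ → ℤ) :=
  Kernel.traj (X := fun _ : ℕ => ℤ) (walkKernel lam ω) 0 (fun _ => 0)

/-- `X_n / n → v` almost surely with respect to the environment and to the walk with bias `lam`. -/
def HasVelocity (P : Measure Env) (lam v : ℝ) : Prop :=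
  ∀ᵐ ω ∂P, ∀ᵐ X ∂(walkLaw lam ω), Tendsto (fun n : ℕ => (X n : ℝ) / (n : ℝ)) atTop (𝓝 v)

open Classical in
/-- The asymptotic velocity `v_X(λ)`: the deterministic number that is the almost sure limit of
`X_n / n` (and `0` if there were no such number). -/
noncomputable def velocity (P : Measure Env) (lam : ℝ) : ℝ :=
  if h : ∃ v : ℝ, HasVelocity P lam v then h.choose else 0

/-- The threshold `λ_- = sup {λ : v_X(λ) < 0}`, with `sup ∅ = -∞`. -/
noncomputable def lamMinus (P : Measure Env) : EReal :=
  sSup ((fun lam : ℝ => (lam : EReal)) '' {lam : ℝ | velocity P lam < 0})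

/-- The threshold `λ_+ = inf {λ : v_X(λ) > 0}`, with `inf ∅ = +∞`. -/
noncomputable def lamPlus (P : Measure Env) : EReal :=
  sInf ((fun lam : ℝ => (lam : EReal)) '' {lam : ℝ | 0 < velocity P lam})

/-- The expectation of a real random variable is well defined in `[-∞, +∞]`: its positive part or
its negative part has finite expectation. -/
def ExpectationDefined {Ω : Type*} [MeasurableSpace Ω] (P : Measure Ω) (f : Ω → ℝ) : Prop :=
  (∫⁻ ω, ENNReal.ofReal (f ω) ∂P) ≠ ⊤ ∨ (∫⁻ ω, ENNReal.ofReal (-f ω) ∂P) ≠ ⊤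

/-- The expectation, with values in `[-∞, +∞]`, of a real random variable whose expectation is well
defined. -/
noncomputable def extExpectation {Ω : Type*} [MeasurableSpace Ω] (P : Measure Ω) (f : Ω → ℝ) :
    EReal :=
  ((∫⁻ ω, ENNReal.ofReal (f ω) ∂P : ENNReal) : EReal)
    - ((∫⁻ ω, ENNReal.ofReal (-f ω) ∂P : ENNReal) : EReal)

end RWRE

/-! The walk has speed `1 / S(λ)` to the right, where
`S(λ) = 1 + 2 ∑_{k ≥ 1} E[ρ_1(λ) ⋯ ρ_k(λ)]` (`slowness`) is the mean time needed to advance by one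
site and `ρ_x(λ) = ρ_x e^{-2λ}` (`odds`), and the same holds to the left after a reflection of the
environment; at most one of the two speeds is not zero. No transience or recurrence criterion is
needed for this.

The upper bound on the speed (`ae_eventually_le_mul`) is valid even when `S(λ)` is infinite. A
truncation of the quenched mean time to go from `x` to `x + 1` is a bounded stationary function `D`
whose primitive `h` has drift at most `1` along the walk (`truncSlowness_drift`), so that `h(X_n)`
grows at most at unit rate by a Chernoff bound (`ae_eventually_height_le`), whereas `h(x) / x` tends
to `E[D]` by the ergodic theorem. If `S(λ)` is infinite in both directions, the velocity is
therefore `0`.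

If `S(λ)` is finite, the environment seen from the walker has a finite invariant measure that is
equivalent to `P` and has an explicit density (`lintegral_viewDensity_step`). The ergodic theorem
under the resulting stationary law of the steps shows that `X_n / n` converges to a limit with mean
`1 / S(λ)` under the normalised law. By the upper bound the limit is at most `1 / S(λ)`, so it is
`1 / S(λ)` almost surely (`hasVelocity_of_slowness_ne_top`); the ergodicity of the process seen from
the walker is not used.

If `S(λ)` is finite, some moment `E[ρ_1(λ) ⋯ ρ_k(λ)]` is less than `1`, and `log y ≤ y - 1` gives
`E[log ρ_0] < 2λ` (`extExpectation_div_two_lt`). With the reflected statement this yields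
`λ_- ≤ E[log ρ_0] / 2 ≤ λ_+`, and that the velocity is `0` when there is equality at a finite value.
As the moments are multiples of `e^{-2λk}`, the function `1 / S` can be discontinuous only at a
point where `S` is finite while it is infinite on the left (`continuous_inv_slowness`). Such a point
would be `λ_+`, and would satisfy `E[log ρ_0] / 2 < λ_+`, which is excluded if `λ_- = λ_+`. -/

namespace RWRE

/-! ### The pointwise ergodic theorem for bounded functions -/

section Birkhoff

variable {α : Type*} {T : α → α}

/-- The running maximum `max (0, S_1 g, …, S_N g)` of the Birkhoff sums of `g`, defined by the
recursion that drives the proof of the maximal ergodic inequality. -/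
noncomputable def maxBirkhoff (T : α → α) (g : α → ℝ) : ℕ → α → ℝ
  | 0 => fun _ => 0
  | N + 1 => fun x => max 0 (g x + maxBirkhoff T g N (T x))

theorem maxBirkhoff_nonneg (g : α → ℝ) (N : ℕ) (x : α) : 0 ≤ maxBirkhoff T g N x := by
  cases N with
  | zero => exact le_rfl
  | succ N => exact le_max_left _ _

theorem maxBirkhoff_le_succ (g : α → ℝ) (N : ℕ) (x : α) :
    maxBirkhoff T g N x ≤ maxBirkhoff T g (N + 1) x := by
  induction N generalizing x with
  | zero => exact le_max_left _ _
  | succ N ih => exact max_le_max le_rfl (by gcongr; exact ih (T x))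

theorem birkhoffSum_le_maxBirkhoff (g : α → ℝ) (N : ℕ) (x : α) :
    birkhoffSum T g N x ≤ maxBirkhoff T g N x := by
  induction N generalizing x with
  | zero => simp [maxBirkhoff]
  | succ N ih =>
    rw [birkhoffSum_succ']
    exact le_max_of_le_right (by gcongr; exact ih (T x))

/-- The upper limit of the Birkhoff averages of `f`. -/
noncomputable def upperAverage (T : α → α) (f : α → ℝ) (x : α) : ℝ :=
  limsup (fun n => birkhoffAverage ℝ T f n x) atTop

theorem abs_birkhoffAverage_le {f : α → ℝ} {B : ℝ} (hB : 0 ≤ B) (hf : ∀ x, |f x| ≤ B) (n : ℕ)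
    (x : α) : |birkhoffAverage ℝ T f n x| ≤ B := by
  rcases Nat.eq_zero_or_pos n with rfl | hn
  · simpa using hB
  · have hn' : (0 : ℝ) < n := by exact_mod_cast hn
    rw [birkhoffAverage, smul_eq_mul, abs_mul, abs_of_pos (inv_pos.2 hn'),
      inv_mul_le_iff₀ hn', birkhoffSum]
    refine (Finset.abs_sum_le_sum_abs _ _).trans ?_
    refine (Finset.sum_le_sum fun k _ => hf (T^[k] x)).trans ?_
    simp

variable {f : α → ℝ} {B : ℝ}

theorem isBoundedUnder_le_birkhoffAverage (hB : 0 ≤ B) (hf : ∀ x, |f x| ≤ B) (x : α) :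
    IsBoundedUnder (· ≤ ·) atTop (fun n => birkhoffAverage ℝ T f n x) :=
  isBoundedUnder_of ⟨B, fun n => (abs_le.1 (abs_birkhoffAverage_le hB hf n x)).2⟩

theorem isBoundedUnder_ge_birkhoffAverage (hB : 0 ≤ B) (hf : ∀ x, |f x| ≤ B) (x : α) :
    IsBoundedUnder (· ≥ ·) atTop (fun n => birkhoffAverage ℝ T f n x) :=
  isBoundedUnder_of ⟨-B, fun n => (abs_le.1 (abs_birkhoffAverage_le hB hf n x)).1⟩

theorem abs_upperAverage_le (hB : 0 ≤ B) (hf : ∀ x, |f x| ≤ B) (x : α) :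
    |upperAverage T f x| ≤ B := by
  refine abs_le.2 ⟨?_, ?_⟩
  · refine le_limsup_of_frequently_le (Frequently.of_forall fun n => ?_)
      (isBoundedUnder_le_birkhoffAverage hB hf x)
    exact (abs_le.1 (abs_birkhoffAverage_le hB hf n x)).1
  · refine limsup_le_of_le (isBoundedUnder_ge_birkhoffAverage hB hf x).isCoboundedUnder_le ?_
    exact Eventually.of_forall fun n => (abs_le.1 (abs_birkhoffAverage_le hB hf n x)).2

theorem upperAverage_apply (hB : 0 ≤ B) (hf : ∀ x, |f x| ≤ B) (x : α) :
    upperAverage T f (T x) = upperAverage T f x := by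
  have hd : Tendsto (fun n => birkhoffAverage ℝ T f n (T x) - birkhoffAverage ℝ T f n x) atTop
      (𝓝 0) := by
    refine tendsto_birkhoffAverage_apply_sub_birkhoffAverage' ℝ ?_ T x
    refine (Metric.isBounded_closedBall (x := (0 : ℝ)) (r := B)).subset ?_
    rintro _ ⟨y, rfl⟩
    simpa using hf y
  refine le_antisymm (le_of_forall_pos_le_add fun ε hε => ?_)
    (le_of_forall_pos_le_add fun ε hε => ?_)
  · rw [upperAverage, upperAverage, ← limsup_add_const atTop _ ε
      (isBoundedUnder_le_birkhoffAverage hB hf x)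
      (isBoundedUnder_ge_birkhoffAverage hB hf x).isCoboundedUnder_le]
    refine limsup_le_limsup ?_
      (isBoundedUnder_ge_birkhoffAverage hB hf _).isCoboundedUnder_le
      (isBoundedUnder_of ⟨B + ε, fun n =>
        by have := (abs_le.1 (abs_birkhoffAverage_le (T := T) hB hf n x)).2; linarith⟩)
    filter_upwards [hd.eventually (gt_mem_nhds hε)] with n hn
    linarith
  · rw [upperAverage, upperAverage, ← limsup_add_const atTop _ ε
      (isBoundedUnder_le_birkhoffAverage hB hf _)
      (isBoundedUnder_ge_birkhoffAverage hB hf _).isCoboundedUnder_le]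
    refine limsup_le_limsup ?_
      (isBoundedUnder_ge_birkhoffAverage hB hf _).isCoboundedUnder_le
      (isBoundedUnder_of ⟨B + ε, fun n =>
        by have := (abs_le.1 (abs_birkhoffAverage_le (T := T) hB hf n (T x))).2; linarith⟩)
    filter_upwards [hd.eventually (lt_mem_nhds (neg_lt_zero.2 hε))] with n hn
    linarith

variable [MeasurableSpace α] {μ : Measure α}

theorem measurable_maxBirkhoff (hT : Measurable T) {g : α → ℝ} (hg : Measurable g) (N : ℕ) :
    Measurable (maxBirkhoff T g N) := by
  induction N with
  | zero => exact measurable_const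
  | succ N ih => exact measurable_const.max (hg.add (ih.comp hT))

theorem integrable_maxBirkhoff (hT : MeasurePreserving T μ μ) {g : α → ℝ} (hg : Integrable g μ)
    (N : ℕ) : Integrable (maxBirkhoff T g N) μ := by
  induction N with
  | zero => exact integrable_zero _ _ _
  | succ N ih =>
    have h : Integrable (fun x => g x + maxBirkhoff T g N (T x)) μ :=
      hg.add (hT.integrable_comp_of_integrable ih)
    exact (integrable_zero _ _ _).sup h

/-- The maximal ergodic inequality. -/
theorem setIntegral_maxBirkhoff_pos_nonneg (hT : MeasurePreserving T μ μ) {g : α → ℝ}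
    (hgm : Measurable g) (hg : Integrable g μ) (N : ℕ) :
    0 ≤ ∫ x in {x | 0 < maxBirkhoff T g N x}, g x ∂μ := by
  cases N with
  | zero => simp [maxBirkhoff]
  | succ N =>
    set m := maxBirkhoff T g (N + 1) with hm
    have hmm : Measurable m := measurable_maxBirkhoff hT.measurable hgm _
    have hmi : Integrable m μ := integrable_maxBirkhoff hT hg _
    have hmT : Integrable (fun x => m (T x)) μ := hT.integrable_comp_of_integrable hmi
    have hE : MeasurableSet {x | 0 < m x} := measurableSet_lt measurable_const hmm
    have h1 : ∫ x in {x | 0 < m x}, (m x - m (T x)) ∂μ ≤ ∫ x in {x | 0 < m x}, g x ∂μ := by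
      refine setIntegral_mono_on (hmi.sub hmT).integrableOn hg.integrableOn hE fun x hx => ?_
      have hx' : m x = g x + maxBirkhoff T g N (T x) := by
        have h0 : 0 < max 0 (g x + maxBirkhoff T g N (T x)) := hx
        rcases lt_max_iff.1 h0 with h | h
        · exact absurd h (lt_irrefl _)
        · exact max_eq_right h.le
      have := maxBirkhoff_le_succ (T := T) g N (T x)
      rw [hx']
      linarith
    have h2 : ∫ x in {x | 0 < m x}, m x ∂μ = ∫ x, m x ∂μ := by
      refine setIntegral_eq_integral_of_forall_compl_eq_zero fun x hx => ?_
      exact le_antisymm (not_lt.1 hx) (maxBirkhoff_nonneg _ _ _)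
    have h3 : ∫ x in {x | 0 < m x}, m (T x) ∂μ ≤ ∫ x, m (T x) ∂μ :=
      setIntegral_le_integral hmT (ae_of_all _ fun x => maxBirkhoff_nonneg _ _ _)
    have h4 : ∫ x, m (T x) ∂μ = ∫ x, m x ∂μ := by
      conv_rhs => rw [← hT.map_eq]
      rw [integral_map hT.aemeasurable hmm.aestronglyMeasurable]
    rw [integral_sub hmi.integrableOn hmT.integrableOn] at h1
    linarith

theorem integral_nonneg_of_exists_birkhoffSum_pos (hT : MeasurePreserving T μ μ) {g : α → ℝ}
    (hgm : Measurable g) (hg : Integrable g μ) (h : ∀ x, ∃ k, 0 < birkhoffSum T g k x) :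
    0 ≤ ∫ x, g x ∂μ := by
  have hmono : Monotone fun N => {x | 0 < maxBirkhoff T g N x} :=
    monotone_nat_of_le_succ fun N x hx => lt_of_lt_of_le hx (maxBirkhoff_le_succ g N x)
  have hU : ⋃ N, {x | 0 < maxBirkhoff T g N x} = Set.univ :=
    Set.eq_univ_of_forall fun x => by
      obtain ⟨k, hk⟩ := h x
      exact Set.mem_iUnion.2 ⟨k, hk.trans_le (birkhoffSum_le_maxBirkhoff g k x)⟩
  have ht := tendsto_setIntegral_of_monotone (μ := μ) (f := g)
    (fun N => measurableSet_lt measurable_const (measurable_maxBirkhoff hT.measurable hgm N))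
    hmono hg.integrableOn
  rw [hU, Measure.restrict_univ] at ht
  exact ge_of_tendsto' ht fun N => setIntegral_maxBirkhoff_pos_nonneg hT hgm hg N

theorem measurable_upperAverage (hT : Measurable T) (hf : Measurable f) :
    Measurable (upperAverage T f) := by
  refine Measurable.limsup fun n => ?_
  unfold birkhoffAverage birkhoffSum
  exact (Finset.measurable_sum _ fun k _ => hf.comp (hT.iterate k)).const_smul ((n : ℝ)⁻¹)

theorem integrable_of_abs_le [IsFiniteMeasure μ] (hfm : Measurable f)
    (hf : ∀ x, |f x| ≤ B) : Integrable f μ :=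
  Integrable.of_bound hfm.aestronglyMeasurable B (ae_of_all _ hf)

theorem integral_upperAverage_le [IsFiniteMeasure μ] (hT : MeasurePreserving T μ μ)
    (hfm : Measurable f) (hB : 0 ≤ B) (hf : ∀ x, |f x| ≤ B) :
    ∫ x, upperAverage T f x ∂μ ≤ ∫ x, f x ∂μ := by
  have hum := measurable_upperAverage hT.measurable hfm
  have hui : Integrable (upperAverage T f) μ := integrable_of_abs_le hum (abs_upperAverage_le hB hf)
  have hfi : Integrable f μ := integrable_of_abs_le hfm hf
  have key : ∀ ε : ℝ, 0 < ε →
      ∫ x, upperAverage T f x ∂μ ≤ ∫ x, f x ∂μ + ε * μ.real Set.univ := by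
    intro ε hε
    have hinv : ∀ x, ∀ k, upperAverage T f (T^[k] x) = upperAverage T f x := by
      intro x k
      induction k with
      | zero => rfl
      | succ k ih => rw [Function.iterate_succ_apply', upperAverage_apply hB hf, ih]
    have h := integral_nonneg_of_exists_birkhoffSum_pos hT
      (g := fun x => f x - (upperAverage T f x - ε)) (hfm.sub (hum.sub measurable_const))
      (hfi.sub (hui.sub (integrable_const ε))) ?_
    · have e : ∫ x, (f x - (upperAverage T f x - ε)) ∂μ
          = ∫ x, f x ∂μ - (∫ x, upperAverage T f x ∂μ - ε * μ.real Set.univ) := by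
        have hi : Integrable (fun x => upperAverage T f x - ε) μ := hui.sub (integrable_const ε)
        rw [integral_sub hfi hi, integral_sub hui (integrable_const ε)]
        simp [mul_comm]
      rw [e] at h
      linarith
    · intro x
      have hlt : upperAverage T f x - ε < upperAverage T f x := by linarith
      have hfr := frequently_lt_of_lt_limsup
        (isBoundedUnder_ge_birkhoffAverage (T := T) hB hf x).isCoboundedUnder_le hlt
      obtain ⟨k, hk, hk0⟩ := (hfr.and_eventually (eventually_gt_atTop 0)).exists
      refine ⟨k, ?_⟩
      have hk' : (0 : ℝ) < k := by exact_mod_cast hk0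
      have : birkhoffSum T (fun x => f x - (upperAverage T f x - ε)) k x
          = birkhoffSum T f k x - k * (upperAverage T f x - ε) := by
        simp [birkhoffSum, hinv]
        ring
      rw [this]
      rw [birkhoffAverage, smul_eq_mul, lt_inv_mul_iff₀ hk'] at hk
      linarith
  refine le_of_forall_pos_le_add fun δ hδ => ?_
  have hm : 0 ≤ μ.real Set.univ := measureReal_nonneg
  refine (key (δ / (μ.real Set.univ + 1)) (by positivity)).trans ?_
  have : δ / (μ.real Set.univ + 1) * μ.real Set.univ ≤ δ := by
    rw [div_mul_eq_mul_div, div_le_iff₀ (by positivity)]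
    nlinarith
  linarith

/-- The pointwise ergodic theorem for a bounded function: the averages converge almost everywhere,
and the limit, their upper limit, has the same integral as the function. -/
theorem tendsto_birkhoffAverage_ae [IsFiniteMeasure μ] (hT : MeasurePreserving T μ μ)
    (hfm : Measurable f) (hB : 0 ≤ B) (hf : ∀ x, |f x| ≤ B) :
    (∀ᵐ x ∂μ, Tendsto (fun n => birkhoffAverage ℝ T f n x) atTop (𝓝 (upperAverage T f x))) ∧
      ∫ x, upperAverage T f x ∂μ = ∫ x, f x ∂μ := by
  have hf' : ∀ x, |(-f) x| ≤ B := fun x => by simpa using hf x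
  have h1 := integral_upperAverage_le hT hfm hB hf
  have h2 := integral_upperAverage_le hT hfm.neg hB hf'
  have hui : Integrable (upperAverage T f) μ :=
    integrable_of_abs_le (measurable_upperAverage hT.measurable hfm) (abs_upperAverage_le hB hf)
  have hui' : Integrable (upperAverage T (-f)) μ :=
    integrable_of_abs_le (measurable_upperAverage hT.measurable hfm.neg)
      (abs_upperAverage_le hB hf')
  -- the lower limit of the averages of `f` is `-upperAverage T (-f)`
  have hle : ∀ x, ∀ c, c < -upperAverage T (-f) x →
      ∀ᶠ n in atTop, c < birkhoffAverage ℝ T f n x := by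
    intro x c hc
    have := eventually_lt_of_limsup_lt (lt_neg_of_lt_neg hc)
      (isBoundedUnder_le_birkhoffAverage (T := T) hB hf' x)
    filter_upwards [this] with n hn
    rw [birkhoffAverage_neg] at hn
    simp only [Pi.neg_apply] at hn
    linarith
  have hge : ∀ x, ∀ c, upperAverage T f x < c → ∀ᶠ n in atTop, birkhoffAverage ℝ T f n x < c :=
    fun x c hc => eventually_lt_of_limsup_lt hc (isBoundedUnder_le_birkhoffAverage (T := T) hB hf x)
  have hnn : ∀ x, 0 ≤ upperAverage T f x + upperAverage T (-f) x := by
    intro x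
    by_contra hlt
    push Not at hlt
    obtain ⟨c, hc1, hc2⟩ := exists_between (show upperAverage T f x < -upperAverage T (-f) x by
      linarith)
    obtain ⟨n, hn1, hn2⟩ := ((hle x c hc2).and (hge x c hc1)).exists
    exact lt_asymm hn1 hn2
  have hsum : ∫ x, (upperAverage T f x + upperAverage T (-f) x) ∂μ ≤ 0 := by
    rw [integral_add hui hui']
    have : ∫ x, (-f) x ∂μ = -∫ x, f x ∂μ := by simp [integral_neg]
    linarith
  have hzero : (fun x => upperAverage T f x + upperAverage T (-f) x) =ᵐ[μ] 0 := by
    rw [← integral_eq_zero_iff_of_nonneg hnn (hui.add hui')]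
    exact le_antisymm hsum (integral_nonneg hnn)
  refine ⟨?_, ?_⟩
  · filter_upwards [hzero] with x hx
    have hx' : upperAverage T f x = -upperAverage T (-f) x := by
      simp only [Pi.zero_apply] at hx; linarith
    refine tendsto_order.2 ⟨fun c hc => hle x c (hx' ▸ hc), hge x⟩
  · refine le_antisymm h1 ?_
    have h3 : ∫ x, (upperAverage T f x + upperAverage T (-f) x) ∂μ = 0 := by
      rw [integral_congr_ae hzero]; simp
    rw [integral_add hui hui'] at h3
    have : ∫ x, (-f) x ∂μ = -∫ x, f x ∂μ := by simp [integral_neg]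
    linarith

/-- Birkhoff's theorem for a bounded function and an ergodic map. -/
theorem tendsto_birkhoffAverage_of_ergodic [IsProbabilityMeasure μ] (hT : Ergodic T μ)
    (hfm : Measurable f) (hB : 0 ≤ B) (hf : ∀ x, |f x| ≤ B) :
    ∀ᵐ x ∂μ, Tendsto (fun n => birkhoffAverage ℝ T f n x) atTop (𝓝 (∫ y, f y ∂μ)) := by
  obtain ⟨h1, h2⟩ := tendsto_birkhoffAverage_ae hT.toMeasurePreserving hfm hB hf
  obtain ⟨c, hc⟩ := hT.toPreErgodic.ae_eq_const_of_ae_eq_comp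
    (measurable_upperAverage hT.measurable hfm) (funext (upperAverage_apply hB hf))
  have hcI : c = ∫ y, f y ∂μ := by
    rw [← h2, integral_congr_ae hc]; simp
  filter_upwards [h1, hc] with x hx hcx
  rw [← hcI]
  simpa [hcx] using hx

end Birkhoff

/-! ### The law of the walk -/

theorem lintegral_stepLaw (lam : ℝ) (ω : Env) (x : ℤ) (u : ℤ → ENNReal) :
    ∫⁻ y, u y ∂(stepLaw lam ω x) =
      ENNReal.ofReal (biasedPlus lam ω x) * u (x + 1)
        + ENNReal.ofReal (biasedMinus lam ω x) * u (x - 1) := by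
  simp [stepLaw, lintegral_add_measure, lintegral_smul_measure]

instance walkLaw_isProbabilityMeasure (lam : ℝ) (ω : Env) :
    IsProbabilityMeasure (walkLaw lam ω) := by
  unfold walkLaw; infer_instance

/-- The Markov property at time `n`, for functions of the past and of the next position. -/
theorem lintegral_walkLaw_succ (lam : ℝ) (ω : Env) (n : ℕ)
    (G : ((i : Finset.Iic n) → (fun _ : ℕ => ℤ) i) → ℤ → ENNReal) :
    ∫⁻ X, G (Preorder.frestrictLe n X) (X (n + 1)) ∂(walkLaw lam ω) =
      ∫⁻ X, ∫⁻ y, G (Preorder.frestrictLe n X) y ∂(stepLaw lam ω (X n)) ∂(walkLaw lam ω) := by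
  have hG : Measurable (Function.uncurry G) := measurable_of_countable _
  have h := Kernel.partialTraj_compProd_eq_map_traj (X := fun _ : ℕ => ℤ)
    (κ := walkKernel lam ω) (Nat.zero_le n) (x₀ := fun _ => 0)
  have h1 := congrArg (fun m => ∫⁻ p, Function.uncurry G p ∂m) h
  simp only at h1
  rw [Measure.lintegral_compProd hG, lintegral_map hG (by fun_prop),
    ← Kernel.traj_map_frestrictLe_apply, lintegral_map (measurable_of_countable _) (by fun_prop)]
    at h1
  exact h1.symm

/-- The Markov property at time `n`, for functions of the current and of the next position. -/
theorem lintegral_walkLaw_pair (lam : ℝ) (ω : Env) (n : ℕ) (G : ℤ → ℤ → ENNReal) :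
    ∫⁻ X, G (X n) (X (n + 1)) ∂(walkLaw lam ω) =
      ∫⁻ X, (ENNReal.ofReal (biasedPlus lam ω (X n)) * G (X n) (X n + 1)
        + ENNReal.ofReal (biasedMinus lam ω (X n)) * G (X n) (X n - 1)) ∂(walkLaw lam ω) := by
  simp_rw [← lintegral_stepLaw]
  exact lintegral_walkLaw_succ lam ω n fun h y => G (h ⟨n, Finset.mem_Iic.2 le_rfl⟩) y

theorem ae_walkLaw_zero (lam : ℝ) (ω : Env) : ∀ᵐ X ∂(walkLaw lam ω), X 0 = 0 := by
  have h := Kernel.traj_map_frestrictLe_apply (X := fun _ : ℕ => ℤ)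
    (κ := walkKernel lam ω) 0 0 (fun _ => 0)
  rw [Kernel.partialTraj_self, Kernel.id_apply] at h
  have h1 : ∀ᵐ y ∂((walkLaw lam ω).map (Preorder.frestrictLe 0)),
      y ⟨0, Finset.mem_Iic.2 le_rfl⟩ = (0 : ℤ) := by
    unfold walkLaw
    rw [h, ae_dirac_iff (MeasurableSet.of_discrete)]
  exact ae_of_ae_map (by fun_prop) h1

theorem ae_walkLaw_succ (lam : ℝ) (ω : Env) :
    ∀ᵐ X ∂(walkLaw lam ω), ∀ n, X (n + 1) = X n + 1 ∨ X (n + 1) = X n - 1 := by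
  rw [ae_all_iff]
  intro n
  have h := lintegral_walkLaw_pair lam ω n
    (fun x y => if y = x + 1 ∨ y = x - 1 then 0 else 1)
  simp only [true_or, or_true, if_true, mul_zero, add_zero, lintegral_zero] at h
  rw [lintegral_eq_zero_iff] at h
  · filter_upwards [h] with X hX
    by_contra hc
    simp [hc] at hX
  · have hm : Measurable fun X : ℕ → ℤ => (X n, X (n + 1)) :=
      (measurable_pi_apply n).prodMk (measurable_pi_apply (n + 1))
    exact (measurable_of_countable
      (fun p : ℤ × ℤ => if p.2 = p.1 + 1 ∨ p.2 = p.1 - 1 then (0 : ENNReal) else 1)).comp hm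

theorem measurableSet_pathCylinder (n : ℕ) (x : ℕ → ℤ) :
    MeasurableSet {X : ℕ → ℤ | ∀ i ≤ n, X i = x i} := by
  have : {X : ℕ → ℤ | ∀ i ≤ n, X i = x i} = ⋂ i ∈ Set.Iic n, (fun X => X i) ⁻¹' {x i} := by
    ext; simp
  rw [this]
  exact MeasurableSet.biInter (Set.to_countable _) fun i _ =>
    measurable_pi_apply i (measurableSet_singleton _)

/-- The probability that the walk follows a given path up to time `n`. -/
theorem walkLaw_pathCylinder (lam : ℝ) (ω : Env) (n : ℕ) (x : ℕ → ℤ) :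
    walkLaw lam ω {X | ∀ i ≤ n, X i = x i} =
      (if x 0 = 0 then 1 else 0) * ∏ i ∈ Finset.range n, stepLaw lam ω (x i) {x (i + 1)} := by
  induction n with
  | zero =>
    simp only [nonpos_iff_eq_zero, forall_eq, Finset.range_zero, Finset.prod_empty, mul_one]
    split_ifs with h
    · rw [h, ← measure_univ (μ := walkLaw lam ω)]
      refine measure_congr (eventuallyEq_set.2 ?_)
      filter_upwards [ae_walkLaw_zero lam ω] with X hX
      simp [hX]
    · rw [← measure_empty (μ := walkLaw lam ω)]
      refine measure_congr (eventuallyEq_set.2 ?_)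
      filter_upwards [ae_walkLaw_zero lam ω] with X hX
      simpa [hX] using Ne.symm h
  | succ n ih =>
    rw [Finset.prod_range_succ, ← mul_assoc, ← ih, ← lintegral_indicator_one
      (measurableSet_pathCylinder _ _)]
    have h := lintegral_walkLaw_succ lam ω n
      (fun h y => (if ∀ i, h i = x i then 1 else 0) * ({x (n + 1)} : Set ℤ).indicator 1 y)
    have e1 : ∀ X : ℕ → ℤ, (∀ i : Finset.Iic n, (Preorder.frestrictLe n X i : ℤ) = x i) ↔
        ∀ i ≤ n, X i = x i := by
      intro X
      simp [Preorder.frestrictLe]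
    have e2 : ∀ X : ℕ → ℤ, ({X | ∀ i ≤ n + 1, X i = x i} : Set (ℕ → ℤ)).indicator 1 X =
        (if ∀ i ≤ n, X i = x i then 1 else 0) *
          ({x (n + 1)} : Set ℤ).indicator (1 : ℤ → ENNReal) (X (n + 1)) := by
      intro X
      by_cases h1 : ∀ i ≤ n, X i = x i
      · by_cases h2 : X (n + 1) = x (n + 1)
        · have h3 : X ∈ {X : ℕ → ℤ | ∀ i ≤ n + 1, X i = x i} := fun i hi =>
            (Nat.le_succ_iff.1 hi).elim (h1 i) fun h => by rw [h]; exact h2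
          rw [Set.indicator_of_mem h3, if_pos h1, Set.indicator_of_mem (by simpa using h2)]
          simp
        · have h3 : X ∉ {X : ℕ → ℤ | ∀ i ≤ n + 1, X i = x i} := fun h => h2 (h (n + 1) le_rfl)
          rw [Set.indicator_of_notMem h3, Set.indicator_of_notMem (by simpa using h2), mul_zero]
      · have h3 : X ∉ {X : ℕ → ℤ | ∀ i ≤ n + 1, X i = x i} := fun h =>
          h1 fun i hi => h i (hi.trans n.le_succ)
        rw [Set.indicator_of_notMem h3, if_neg h1, zero_mul]
    simp_rw [e2]
    simp only [e1] at h
    rw [h, ← lintegral_indicator_one (measurableSet_pathCylinder _ _),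
      ← lintegral_mul_const _ (measurable_one.indicator (measurableSet_pathCylinder _ _))]
    refine lintegral_congr fun X => ?_
    rw [lintegral_const_mul _ (measurable_of_countable _),
      lintegral_indicator_one (measurableSet_singleton _)]
    by_cases h1 : ∀ i ≤ n, X i = x i
    · rw [if_pos h1, Set.indicator_of_mem (show X ∈ {X : ℕ → ℤ | ∀ i ≤ n, X i = x i} from h1),
        h1 n le_rfl]
      rfl
    · rw [if_neg h1, Set.indicator_of_notMem
        (show X ∉ {X : ℕ → ℤ | ∀ i ≤ n, X i = x i} from h1), zero_mul, zero_mul]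

/-- The extension of a finite path by `0`. -/
def extendPath (n : ℕ) (a : (i : Finset.Iic n) → (fun _ : ℕ => ℤ) i) (i : ℕ) : ℤ :=
  if h : i ≤ n then a ⟨i, Finset.mem_Iic.2 h⟩ else 0

theorem frestrictLe_preimage_singleton (n : ℕ) (a : (i : Finset.Iic n) → (fun _ : ℕ => ℤ) i) :
    (Preorder.frestrictLe n : (ℕ → ℤ) → _) ⁻¹' {a} = {X | ∀ i ≤ n, X i = extendPath n a i} := by
  ext X
  simp only [Set.mem_preimage, Set.mem_singleton_iff, Set.mem_ofPred_eq, funext_iff]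
  refine ⟨fun h i hi => ?_, fun h i => ?_⟩
  · rw [extendPath, dif_pos hi, ← h]
    rfl
  · have hi := Finset.mem_Iic.1 i.2
    have := h i hi
    rw [extendPath, dif_pos hi] at this
    exact this

/-- Two finite measures on paths that agree on all cylinders are equal. -/
theorem measure_path_ext {μ ν : Measure (ℕ → ℤ)} [IsFiniteMeasure μ]
    (h : ∀ n (x : ℕ → ℤ), μ {X | ∀ i ≤ n, X i = x i} = ν {X | ∀ i ≤ n, X i = x i}) : μ = ν := by
  have hmap : ∀ n, μ.map (Preorder.frestrictLe (π := fun _ : ℕ => ℤ) n)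
      = ν.map (Preorder.frestrictLe (π := fun _ : ℕ => ℤ) n) := by
    intro n
    refine Measure.ext_of_singleton fun a => ?_
    rw [Measure.map_apply (by fun_prop) (measurableSet_singleton _),
      Measure.map_apply (by fun_prop) (measurableSet_singleton _),
      frestrictLe_preimage_singleton, h]
  have hcyl : ∀ n (S : Set ((i : Finset.Iic n) → (fun _ : ℕ => ℤ) i)),
      μ (Preorder.frestrictLe n ⁻¹' S) = ν (Preorder.frestrictLe n ⁻¹' S) := by
    intro n S
    rw [← Measure.map_apply (by fun_prop) MeasurableSet.of_discrete, hmap,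
      Measure.map_apply (by fun_prop) MeasurableSet.of_discrete]
  refine ext_of_generate_finite (measurableCylinders fun _ : ℕ => ℤ)
    generateFrom_measurableCylinders.symm isPiSystem_measurableCylinders (fun s hs => ?_)
    (hcyl 0 Set.univ)
  obtain ⟨N, S, -, rfl⟩ : ∃ N S, MeasurableSet S ∧ s = cylinder (Finset.Iic N) S := by
    simpa [measurableCylinders_nat] using hs
  exact hcyl N S

/-- A family of probability measures on paths is measurable if the probabilities of cylinders
are. -/
theorem measurable_path_measure {β : Type*} [MeasurableSpace β] {κ : β → Measure (ℕ → ℤ)}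
    [∀ b, IsProbabilityMeasure (κ b)]
    (h : ∀ n (x : ℕ → ℤ), Measurable fun b => κ b {X | ∀ i ≤ n, X i = x i}) : Measurable κ := by
  refine Measurable.measure_of_isPiSystem_of_isProbabilityMeasure
    (S := measurableCylinders fun _ : ℕ => ℤ)
    generateFrom_measurableCylinders.symm isPiSystem_measurableCylinders fun s hs => ?_
  obtain ⟨N, S, -, rfl⟩ : ∃ N S, MeasurableSet S ∧ s = cylinder (Finset.Iic N) S := by
    simpa [measurableCylinders_nat] using hs
  have e : ∀ b, κ b (cylinder (Finset.Iic N) S) = ∑' a : S,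
      κ b {X | ∀ i ≤ N, X i = extendPath N (a : (i : Finset.Iic N) → (fun _ : ℕ => ℤ) i) i} := by
    intro b
    have h1 : cylinder (Finset.Iic N) S = ⋃ a : S,
        {X : ℕ → ℤ | ∀ i ≤ N, X i = extendPath N (a : (i : Finset.Iic N) → _) i} := by
      simp_rw [← frestrictLe_preimage_singleton, ← Set.preimage_iUnion]
      simp [cylinder, Preorder.frestrictLe]
    rw [h1, measure_iUnion]
    · intro a a' haa'
      simp_rw [Function.onFun, ← frestrictLe_preimage_singleton]
      refine Disjoint.preimage _ (Set.disjoint_singleton.2 fun h => haa' (Subtype.ext h))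
    · exact fun a => measurableSet_pathCylinder _ _
  simp_rw [e]
  exact Measurable.tsum fun a => h _ _

theorem stepLaw_singleton (lam : ℝ) (ω : Env) (x y : ℤ) :
    stepLaw lam ω x {y} = (if y = x + 1 then ENNReal.ofReal (biasedPlus lam ω x) else 0)
      + (if y = x - 1 then ENNReal.ofReal (biasedMinus lam ω x) else 0) := by
  rw [← lintegral_indicator_one (measurableSet_singleton _), lintegral_stepLaw]
  by_cases h1 : y = x + 1 <;> by_cases h2 : y = x - 1 <;>
    simp [Set.indicator, h1, h2, eq_comm]

theorem measurable_pPlus (x : ℤ) : Measurable fun ω : Env => pPlus ω x :=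
  measurable_subtype_coe.comp (measurable_pi_apply x)

theorem measurable_pMinus (x : ℤ) : Measurable fun ω : Env => pMinus ω x :=
  measurable_const.sub (measurable_pPlus x)

theorem measurable_biasedPlus (lam : ℝ) (x : ℤ) : Measurable fun ω => biasedPlus lam ω x := by
  have h1 := measurable_pPlus x
  have h2 := measurable_pMinus x
  unfold biasedPlus
  fun_prop

theorem measurable_biasedMinus (lam : ℝ) (x : ℤ) : Measurable fun ω => biasedMinus lam ω x := by
  have h1 := measurable_pPlus x
  have h2 := measurable_pMinus x
  unfold biasedMinus
  fun_prop

theorem measurable_stepLaw_singleton (lam : ℝ) (x y : ℤ) :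
    Measurable fun ω => stepLaw lam ω x {y} := by
  simp_rw [stepLaw_singleton]
  refine Measurable.add ?_ ?_
  · split_ifs
    · exact (measurable_biasedPlus lam x).ennreal_ofReal
    · exact measurable_const
  · split_ifs
    · exact (measurable_biasedMinus lam x).ennreal_ofReal
    · exact measurable_const

/-- The quenched laws as a kernel from environments to paths. -/
noncomputable def walkLawKernel (lam : ℝ) : Kernel Env (ℕ → ℤ) where
  toFun := walkLaw lam
  measurable' := measurable_path_measure fun n x => by
    simp_rw [walkLaw_pathCylinder]
    exact (Finset.measurable_prod _ fun i _ => measurable_stepLaw_singleton _ _ _).const_mul _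

instance walkLawKernel_isMarkovKernel (lam : ℝ) : IsMarkovKernel (walkLawKernel lam) :=
  ⟨fun ω => walkLaw_isProbabilityMeasure lam ω⟩

/-! ### Reflection and translation of the environment -/

/-- The reflection of an environment at the origin: the jump probabilities to the right at `x`
become those to the left at `-x`. -/
def reflect (ω : Env) : Env := fun x => ⟨1 - ω (-x), by
  have h := (ω (-x)).2
  exact ⟨by linarith [h.2], by linarith [h.1]⟩⟩

theorem measurable_reflect : Measurable reflect :=
  measurable_pi_lambda _ fun x => Measurable.subtype_mk (measurable_pMinus (-x))

theorem pPlus_reflect (ω : Env) (x : ℤ) : pPlus (reflect ω) x = pMinus ω (-x) := rfl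

theorem pMinus_reflect (ω : Env) (x : ℤ) : pMinus (reflect ω) x = pPlus ω (-x) := by
  simp [pMinus, pPlus, reflect]

theorem biasedPlus_reflect (lam : ℝ) (ω : Env) (x : ℤ) :
    biasedPlus (-lam) (reflect ω) x = biasedMinus lam ω (-x) := by
  rw [biasedPlus, biasedMinus, pPlus_reflect, pMinus_reflect, neg_neg, add_comm]

theorem biasedMinus_reflect (lam : ℝ) (ω : Env) (x : ℤ) :
    biasedMinus (-lam) (reflect ω) x = biasedPlus lam ω (-x) := by
  rw [biasedPlus, biasedMinus, pPlus_reflect, pMinus_reflect, neg_neg, add_comm]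

/-- The walk in the reflected environment with the opposite bias is the reflected walk. -/
theorem walkLaw_reflect (lam : ℝ) (ω : Env) :
    walkLaw (-lam) (reflect ω) = (walkLaw lam ω).map fun X n => -X n := by
  refine measure_path_ext fun n x => ?_
  have hm : Measurable fun (X : ℕ → ℤ) n => -X n :=
    measurable_pi_lambda _ fun n => (measurable_pi_apply n).neg
  have hs : (fun (X : ℕ → ℤ) n => -X n) ⁻¹' {X | ∀ i ≤ n, X i = x i}
      = {X | ∀ i ≤ n, X i = -x i} := by
    ext X; simp [neg_eq_iff_eq_neg]
  rw [Measure.map_apply hm (measurableSet_pathCylinder _ _), hs,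
    walkLaw_pathCylinder, walkLaw_pathCylinder lam ω n fun i => -x i]
  congr 1
  · simp
  · refine Finset.prod_congr rfl fun i _ => ?_
    have e1 : (-x (i + 1) = -x i + 1) ↔ x (i + 1) = x i - 1 := by
      constructor <;> intro h <;> linarith
    have e2 : (-x (i + 1) = -x i - 1) ↔ x (i + 1) = x i + 1 := by
      constructor <;> intro h <;> linarith
    simp only [stepLaw_singleton, biasedPlus_reflect, biasedMinus_reflect, e1, e2]
    rw [add_comm]

/-- The translation of environments by `z`. -/
def translate (z : ℤ) (ω : Env) : Env := fun x => ω (x + z)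

theorem translate_one : translate 1 = shift := rfl

theorem translate_zero (ω : Env) : translate 0 ω = ω := by
  funext x; simp [translate]

theorem translate_translate (y z : ℤ) (ω : Env) :
    translate y (translate z ω) = translate (y + z) ω := by
  funext x; simp [translate, add_assoc]

theorem measurable_translate (z : ℤ) : Measurable (translate z) :=
  measurable_pi_lambda _ fun x => measurable_pi_apply (x + z)

/-- The shift as an automorphism of the space of environments. -/
def shiftEquiv : Env ≃ᵐ Env where
  toFun := translate 1
  invFun := translate (-1)
  left_inv ω := by rw [translate_translate]; exact translate_zero ω
  right_inv ω := by rw [translate_translate]; exact translate_zero ω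
  measurable_toFun := measurable_translate 1
  measurable_invFun := measurable_translate (-1)

section Reflection

variable {P : Measure Env}

theorem measurePreserving_translate_neg_one (hP : MeasurePreserving shift P P) :
    MeasurePreserving (translate (-1)) P P :=
  MeasurePreserving.symm shiftEquiv hP

theorem ergodic_map_reflect (hP : Ergodic shift P) : Ergodic shift (P.map reflect) := by
  have h1 : Ergodic (translate (-1)) P := Ergodic.symm (e := shiftEquiv) hP
  have hr : MeasurePreserving reflect P (P.map reflect) := ⟨measurable_reflect, rfl⟩
  refine hr.ergodic_of_ergodic_semiconj h1 (measurable_translate 1) fun ω => ?_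
  funext x
  have : -(x + 1) = -x + -1 := by ring
  simp only [reflect, shift, translate, this]

theorem isProbabilityMeasure_map_reflect [IsProbabilityMeasure P] :
    IsProbabilityMeasure (P.map reflect) :=
  Measure.isProbabilityMeasure_map measurable_reflect.aemeasurable

/-- Almost sure properties of the walk with bias `-lam` in the reflected environment hold for the
reflection of the walk with bias `lam`. -/
theorem ae_walkLaw_of_reflect {lam : ℝ} {p : (ℕ → ℤ) → Prop}
    (h : ∀ᵐ ω ∂(P.map reflect), ∀ᵐ X ∂(walkLaw (-lam) ω), p X) :
    ∀ᵐ ω ∂P, ∀ᵐ X ∂(walkLaw lam ω), p fun n => -X n := by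
  filter_upwards [ae_of_ae_map measurable_reflect.aemeasurable h] with ω hω
  rw [walkLaw_reflect] at hω
  exact ae_of_ae_map
    (measurable_pi_lambda _ fun n => (measurable_pi_apply n).neg).aemeasurable hω

theorem HasVelocity.of_reflect {lam v : ℝ} (h : HasVelocity (P.map reflect) (-lam) v) :
    HasVelocity P lam (-v) := by
  filter_upwards [ae_walkLaw_of_reflect h] with ω hω
  filter_upwards [hω] with X hX
  simpa [neg_div] using hX.neg

theorem HasVelocity.unique [IsProbabilityMeasure P] {lam v w : ℝ} (hv : HasVelocity P lam v)
    (hw : HasVelocity P lam w) : v = w := by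
  obtain ⟨ω, h1, h2⟩ := (hv.and hw).exists
  obtain ⟨X, h3, h4⟩ := (h1.and h2).exists
  exact tendsto_nhds_unique h3 h4

theorem HasVelocity.velocity_eq [IsProbabilityMeasure P] {lam v : ℝ} (h : HasVelocity P lam v) :
    velocity P lam = v := by
  have he : ∃ v, HasVelocity P lam v := ⟨v, h⟩
  rw [velocity, dif_pos he]
  exact he.choose_spec.unique h

end Reflection

/-! ### An upper bound for the walk from a height function -/

/-- A height function with bounded increments whose drift along the walk is at most `1` grows at
most at unit rate along the walk. The reason is an exponential Chernoff bound together with the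
Borel–Cantelli lemma. -/
theorem ae_eventually_height_le {lam : ℝ} {ω : Env} {h : ℤ → ℝ} {B : ℝ} (h0 : h 0 = 0)
    (hB : ∀ x, |h (x + 1) - h x| ≤ B)
    (hd : ∀ x, biasedPlus lam ω x * h (x + 1) + biasedMinus lam ω x * h (x - 1) ≤ h x + 1)
    {ε : ℝ} (hε : 0 < ε) :
    ∀ᵐ X ∂(walkLaw lam ω), ∀ᶠ n : ℕ in atTop, h (X n) < (1 + ε) * n := by
  have hB0 : 0 ≤ B := (abs_nonneg _).trans (hB 0)
  set C := B + 1 with hC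
  have hC0 : 0 < C := by linarith
  set t := min (1 / C) (ε / (2 * C ^ 2)) with ht
  have ht0 : 0 < t := lt_min (by positivity) (by positivity)
  have htC : t * C ≤ 1 := by
    have := min_le_left (1 / C) (ε / (2 * C ^ 2))
    rw [← ht, le_div_iff₀ hC0] at this
    exact this
  have htε : t * C ^ 2 ≤ ε / 2 := by
    have := min_le_right (1 / C) (ε / (2 * C ^ 2))
    rw [← ht, le_div_iff₀ (by positivity)] at this
    linarith
  set q := Real.exp (t + t ^ 2 * C ^ 2) with hq
  set s := Real.exp (t * (1 + ε)) with hs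
  have hquad : ∀ d : ℝ, |d| ≤ C → Real.exp (t * d) ≤ 1 + t * d + t ^ 2 * C ^ 2 := by
    intro d hdC
    have h1 : |t * d| ≤ 1 := by
      rw [abs_mul, abs_of_pos ht0]
      exact (mul_le_mul_of_nonneg_left hdC ht0.le).trans htC
    have h2 := (abs_le.1 (Real.abs_exp_sub_one_sub_id_le h1)).2
    have h3 : (t * d) ^ 2 ≤ t ^ 2 * C ^ 2 := by
      rw [mul_pow]
      have : d ^ 2 ≤ C ^ 2 := sq_le_sq' (abs_le.1 hdC).1 (abs_le.1 hdC).2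
      gcongr
    linarith
  have hstep : ∀ x, biasedPlus lam ω x * Real.exp (t * h (x + 1))
      + biasedMinus lam ω x * Real.exp (t * h (x - 1)) ≤ q * Real.exp (t * h x) := by
    intro x
    have ha := biasedPlus_nonneg lam ω x
    have hb := biasedMinus_nonneg lam ω x
    have hab := biasedPlus_add_biasedMinus lam ω x
    have hp : |h (x + 1) - h x - 1| ≤ C := by
      refine (abs_sub _ _).trans ?_
      rw [abs_one]
      linarith [hB x]
    have hm : |h (x - 1) - h x - 1| ≤ C := by
      refine (abs_sub _ _).trans ?_
      have := hB (x - 1)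
      rw [sub_add_cancel, abs_sub_comm] at this
      rw [abs_one]
      linarith
    have e : ∀ y, Real.exp (t * h y)
        = Real.exp (t * (h y - h x - 1)) * (Real.exp t * Real.exp (t * h x)) := by
      intro y
      rw [← Real.exp_add, ← Real.exp_add]
      congr 1
      ring
    have key : biasedPlus lam ω x * Real.exp (t * (h (x + 1) - h x - 1))
        + biasedMinus lam ω x * Real.exp (t * (h (x - 1) - h x - 1))
        ≤ Real.exp (t ^ 2 * C ^ 2) := by
      have h1 := mul_le_mul_of_nonneg_left (hquad _ hp) ha
      have h2 := mul_le_mul_of_nonneg_left (hquad _ hm) hb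
      have h3 := Real.add_one_le_exp (t ^ 2 * C ^ 2)
      have h4 := mul_le_mul_of_nonneg_left (hd x) ht0.le
      have h5 : biasedMinus lam ω x = 1 - biasedPlus lam ω x := by linarith
      rw [h5] at h2 h4 ⊢
      nlinarith
    have h6 := mul_le_mul_of_nonneg_right key
      (show 0 ≤ Real.exp t * Real.exp (t * h x) by positivity)
    rw [e (x + 1), e (x - 1), hq, Real.exp_add]
    linarith
  have hmoment : ∀ n : ℕ, ∫⁻ X, ENNReal.ofReal (Real.exp (t * h (X n))) ∂(walkLaw lam ω)
      ≤ ENNReal.ofReal (q ^ n) := by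
    intro n
    induction n with
    | zero =>
      rw [lintegral_congr_ae (g := fun _ => 1)]
      · simp
      · filter_upwards [ae_walkLaw_zero lam ω] with X hX
        simp [hX, h0]
    | succ n ih =>
      rw [lintegral_walkLaw_pair lam ω n fun _ y => ENNReal.ofReal (Real.exp (t * h y))]
      calc _ ≤ ∫⁻ X, ENNReal.ofReal q * ENNReal.ofReal (Real.exp (t * h (X n)))
              ∂(walkLaw lam ω) := by
            refine lintegral_mono fun X => ?_
            simp only
            rw [← ENNReal.ofReal_mul (biasedPlus_nonneg _ _ _),
              ← ENNReal.ofReal_mul (biasedMinus_nonneg _ _ _), ← ENNReal.ofReal_add,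
              ← ENNReal.ofReal_mul (Real.exp_pos _).le]
            · exact ENNReal.ofReal_le_ofReal (hstep (X n))
            · exact mul_nonneg (biasedPlus_nonneg _ _ _) (Real.exp_pos _).le
            · exact mul_nonneg (biasedMinus_nonneg _ _ _) (Real.exp_pos _).le
        _ ≤ ENNReal.ofReal q * ENNReal.ofReal (q ^ n) := by
            rw [lintegral_const_mul' _ _ ENNReal.ofReal_ne_top]
            gcongr
        _ = ENNReal.ofReal (q ^ (n + 1)) := by
            rw [← ENNReal.ofReal_mul (Real.exp_pos _).le, pow_succ' q n]
  have hs0 : 0 < s := Real.exp_pos _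
  have hq0 : 0 < q := Real.exp_pos _
  have hprob : ∀ n : ℕ, walkLaw lam ω {X | (1 + ε) * n ≤ h (X n)}
      ≤ ENNReal.ofReal (q / s) ^ n := by
    intro n
    have hm : Measurable fun X : ℕ → ℤ => ENNReal.ofReal (Real.exp (t * h (X n))) :=
      (measurable_of_countable fun y : ℤ => ENNReal.ofReal (Real.exp (t * h y))).comp
        (measurable_pi_apply n)
    have h1 := mul_meas_ge_le_lintegral (μ := walkLaw lam ω) hm (ENNReal.ofReal (s ^ n))
    have h2 : {X : ℕ → ℤ | (1 + ε) * n ≤ h (X n)}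
        ⊆ {X | ENNReal.ofReal (s ^ n) ≤ ENNReal.ofReal (Real.exp (t * h (X n)))} := by
      intro X hX
      refine ENNReal.ofReal_le_ofReal ?_
      rw [hs, ← Real.exp_nat_mul]
      refine Real.exp_le_exp.2 ?_
      have := mul_le_mul_of_nonneg_left (show (1 + ε) * n ≤ h (X n) from hX) ht0.le
      linarith
    have h3 := (mul_le_mul_right (measure_mono h2) (ENNReal.ofReal (s ^ n))).trans
      (h1.trans (hmoment n))
    rw [← ENNReal.ofReal_pow (by positivity), div_pow, ENNReal.ofReal_div_of_pos (by positivity)]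
    rw [ENNReal.le_div_iff_mul_le (Or.inl (by simpa using pow_pos hs0 n))
      (Or.inl ENNReal.ofReal_ne_top), mul_comm]
    exact h3
  have hqs : q / s < 1 := by
    rw [div_lt_one hs0, hq, hs, Real.exp_lt_exp]
    nlinarith
  have hsum : ∑' n : ℕ, walkLaw lam ω {X | (1 + ε) * n ≤ h (X n)} ≠ ⊤ := by
    refine ne_top_of_le_ne_top ?_ (ENNReal.tsum_le_tsum hprob)
    rw [ENNReal.tsum_geometric]
    refine ENNReal.inv_ne_top.2 (tsub_pos_iff_lt.2 ?_).ne'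
    rw [← ENNReal.ofReal_one]
    exact (ENNReal.ofReal_lt_ofReal_iff zero_lt_one).2 hqs
  filter_upwards [ae_eventually_notMem hsum] with X hX
  filter_upwards [hX] with n hn
  simpa using hn

/-- A function on `ℤ` has a primitive. -/
theorem exists_int_primitive (D : ℤ → ℝ) :
    ∃ h : ℤ → ℝ, (∀ x, h (x + 1) = h x + D x) ∧ ∀ n : ℕ, h n = ∑ k ∈ Finset.range n, D k := by
  refine ⟨fun x => ∑ k ∈ Finset.range x.toNat, D k
    - ∑ k ∈ Finset.range (-x).toNat, D (-(k : ℤ) - 1), fun x => ?_, fun n => by simp⟩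
  rcases le_or_gt 0 x with hx | hx
  · lift x to ℕ using hx
    have e1 : ((x : ℤ) + 1).toNat = x + 1 := by omega
    have e2 : (-((x : ℤ) + 1)).toNat = 0 := by omega
    have e3 : (-(x : ℤ)).toNat = 0 := by omega
    simp only [e1, e2, e3, Int.toNat_natCast, Finset.sum_range_succ, Finset.range_zero,
      Finset.sum_empty]
    ring
  · obtain ⟨m, rfl⟩ : ∃ m : ℕ, x = -(m : ℤ) - 1 := ⟨(-x - 1).toNat, by omega⟩
    have e1 : (-(m : ℤ) - 1 + 1).toNat = 0 := by omega
    have e2 : (-(-(m : ℤ) - 1 + 1)).toNat = m := by omega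
    have e3 : (-(m : ℤ) - 1).toNat = 0 := by omega
    have e4 : (-(-(m : ℤ) - 1)).toNat = m + 1 := by omega
    simp only [e1, e2, e3, e4, Finset.sum_range_succ, Finset.range_zero, Finset.sum_empty]
    ring

/-! ### The slowness -/

/-- The odds of a jump of the biased walk to the left, `ω_x^-(λ) / ω_x^+(λ)`. -/
noncomputable def odds (lam : ℝ) (ω : Env) (x : ℤ) : ℝ := rho ω x * Real.exp (-2 * lam)

theorem odds_pos (lam : ℝ) (ω : Env) (x : ℤ) : 0 < odds lam ω x :=
  mul_pos (div_pos (pMinus_pos ω x) (pPlus_pos ω x)) (Real.exp_pos _)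

theorem biasedPlus_mul_odds (lam : ℝ) (ω : Env) (x : ℤ) :
    biasedPlus lam ω x * odds lam ω x = biasedMinus lam ω x := by
  have h1 := (pPlus_pos ω x).ne'
  have h2 := (biased_denom_pos lam ω x).ne'
  have h3 : Real.exp (-lam) = Real.exp lam * Real.exp (-2 * lam) := by
    rw [← Real.exp_add]; ring_nf
  rw [biasedPlus, biasedMinus, odds, rho]
  rw [div_mul_eq_mul_div]
  congr 1
  rw [h3]
  field_simp

theorem biasedPlus_mul_one_add_odds (lam : ℝ) (ω : Env) (x : ℤ) :
    biasedPlus lam ω x * (1 + odds lam ω x) = 1 := by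
  rw [mul_add, mul_one, biasedPlus_mul_odds, biasedPlus_add_biasedMinus]

theorem measurable_rho (x : ℤ) : Measurable fun ω => rho ω x :=
  (measurable_pMinus x).div (measurable_pPlus x)

theorem measurable_odds (lam : ℝ) (x : ℤ) : Measurable fun ω => odds lam ω x :=
  (measurable_rho x).mul_const _

theorem odds_translate (lam : ℝ) (z : ℤ) (ω : Env) (x : ℤ) :
    odds lam (translate z ω) x = odds lam ω (x + z) := rfl

theorem shift_iterate (n : ℕ) (ω : Env) : shift^[n] ω = translate n ω := by
  induction n with
  | zero => exact (translate_zero ω).symm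
  | succ n ih =>
    rw [Function.iterate_succ_apply', ih, ← translate_one, translate_translate]
    push_cast
    rw [add_comm]

/-- The moments `E[ρ_1(λ) ⋯ ρ_k(λ)]` of the odds. -/
noncomputable def oddsMoment (P : Measure Env) (lam : ℝ) (k : ℕ) : ENNReal :=
  ∫⁻ ω, ∏ i ∈ Finset.range k, ENNReal.ofReal (odds lam ω ((i : ℤ) + 1)) ∂P

/-- The mean time the biased walk needs to advance by one site,
`1 + 2 ∑_{k ≥ 1} E[ρ_1(λ) ⋯ ρ_k(λ)]`. -/
noncomputable def slowness (P : Measure Env) (lam : ℝ) : ENNReal :=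
  1 + 2 * ∑' k, oddsMoment P lam (k + 1)

theorem one_le_slowness (P : Measure Env) (lam : ℝ) : 1 ≤ slowness P lam := le_self_add

theorem oddsMoment_zero (P : Measure Env) [IsProbabilityMeasure P] (lam : ℝ) :
    oddsMoment P lam 0 = 1 := by
  simp [oddsMoment]

/-- The product of the odds at the `k` sites `x, x - 1, …, x - k + 1`. -/
noncomputable def oddsProd (lam : ℝ) (k : ℕ) (ω : Env) (x : ℤ) : ENNReal :=
  ∏ i ∈ Finset.range k, ENNReal.ofReal (odds lam ω (x - i))

theorem measurable_oddsProd (lam : ℝ) (k : ℕ) (x : ℤ) :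
    Measurable fun ω => oddsProd lam k ω x :=
  Finset.measurable_prod _ fun _ _ => (measurable_odds _ _).ennreal_ofReal

theorem oddsProd_succ (lam : ℝ) (k : ℕ) (ω : Env) (x : ℤ) :
    oddsProd lam (k + 1) ω x = ENNReal.ofReal (odds lam ω x) * oddsProd lam k ω (x - 1) := by
  rw [oddsProd, Finset.prod_range_succ', mul_comm]
  congr 1
  · simp
  · refine Finset.prod_congr rfl fun i _ => ?_
    congr 2
    push_cast
    ring

theorem lintegral_oddsProd {P : Measure Env} (hP : MeasurePreserving shift P P) (lam : ℝ) (k : ℕ) :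
    ∫⁻ ω, oddsProd lam k ω 0 ∂P = oddsMoment P lam k := by
  rw [← (hP.iterate k).lintegral_comp (measurable_oddsProd lam k 0)]
  refine lintegral_congr fun ω => ?_
  rw [shift_iterate, oddsProd, ← Finset.prod_range_reflect]
  refine Finset.prod_congr rfl fun i hi => ?_
  rw [odds_translate]
  congr 2
  have := Finset.mem_range.1 hi
  omega

/-- A truncation of the quenched mean time `T x` to go from `x` to `x + 1`. It is obtained from the
recursion `T x = 1 / ω_x^+(λ) + ρ_x(λ) T (x - 1)`, where `1 / ω_x^+(λ) = 1 + ρ_x(λ)`, started from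
`0` at the site `x - K` and cut off at the level `M` at every step. -/
noncomputable def truncSlowness (lam M : ℝ) : ℕ → Env → ℤ → ℝ
  | 0 => fun _ _ => 0
  | K + 1 => fun ω x =>
      min M (1 + odds lam ω x + odds lam ω x * truncSlowness lam M K ω (x - 1))

/-- The untruncated version of `truncSlowness`. -/
noncomputable def finSlowness (lam : ℝ) : ℕ → Env → ℤ → ℝ
  | 0 => fun _ _ => 0
  | K + 1 => fun ω x => 1 + odds lam ω x + odds lam ω x * finSlowness lam K ω (x - 1)

section truncSlowness

variable {lam M : ℝ}

theorem truncSlowness_nonneg (hM : 0 ≤ M) (K : ℕ) (ω : Env) (x : ℤ) :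
    0 ≤ truncSlowness lam M K ω x := by
  induction K generalizing x with
  | zero => exact le_rfl
  | succ K ih =>
    have h1 := odds_pos lam ω x
    have h2 := ih (x - 1)
    exact le_min hM (by positivity)

theorem truncSlowness_le (hM : 0 ≤ M) (K : ℕ) (ω : Env) (x : ℤ) :
    truncSlowness lam M K ω x ≤ M := by
  cases K with
  | zero => exact hM
  | succ K => exact min_le_left _ _

theorem truncSlowness_le_succ (hM : 0 ≤ M) (K : ℕ) (ω : Env) (x : ℤ) :
    truncSlowness lam M K ω x ≤ truncSlowness lam M (K + 1) ω x := by
  induction K generalizing x with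
  | zero => exact truncSlowness_nonneg hM _ _ _
  | succ K ih =>
    have h1 := odds_pos lam ω x
    refine min_le_min le_rfl ?_
    gcongr
    exact ih (x - 1)

theorem measurable_truncSlowness (K : ℕ) (x : ℤ) :
    Measurable fun ω => truncSlowness lam M K ω x := by
  induction K generalizing x with
  | zero => exact measurable_const
  | succ K ih =>
    have h := measurable_odds lam x
    exact measurable_const.min ((measurable_const.add h).add (h.mul (ih (x - 1))))

theorem truncSlowness_translate (K : ℕ) (z : ℤ) (ω : Env) (x : ℤ) :
    truncSlowness lam M K (translate z ω) x = truncSlowness lam M K ω (x + z) := by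
  induction K generalizing x with
  | zero => rfl
  | succ K ih =>
    have e : x - 1 + z = x + z - 1 := by ring
    simp only [truncSlowness, ih, odds_translate, e]

/-- The truncated slowness has drift at most `1`: this is where truncating at every stage of the
recursion, rather than at the end, matters. -/
theorem truncSlowness_drift (hM : 0 ≤ M) (K : ℕ) (ω : Env) (x : ℤ) :
    biasedPlus lam ω x * truncSlowness lam M K ω x ≤
      1 + biasedMinus lam ω x * truncSlowness lam M K ω (x - 1) := by
  have ha := biasedPlus_nonneg lam ω x
  have hb := biasedMinus_nonneg lam ω x
  cases K with
  | zero => simp [truncSlowness]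
  | succ K =>
    have h1 : biasedPlus lam ω x * truncSlowness lam M (K + 1) ω x ≤ biasedPlus lam ω x *
        (1 + odds lam ω x + odds lam ω x * truncSlowness lam M K ω (x - 1)) :=
      mul_le_mul_of_nonneg_left (min_le_right _ _) ha
    have h2 := mul_le_mul_of_nonneg_left (truncSlowness_le_succ (lam := lam) hM K ω (x - 1)) hb
    rw [mul_add, biasedPlus_mul_one_add_odds, ← mul_assoc, biasedPlus_mul_odds] at h1
    linarith

end truncSlowness

theorem finSlowness_nonneg (lam : ℝ) (K : ℕ) (ω : Env) (x : ℤ) : 0 ≤ finSlowness lam K ω x := by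
  induction K generalizing x with
  | zero => exact le_rfl
  | succ K ih =>
    have h1 := odds_pos lam ω x
    have h2 := ih (x - 1)
    simp only [finSlowness]
    positivity

theorem eventually_truncSlowness_eq (lam : ℝ) (K : ℕ) (ω : Env) (x : ℤ) :
    ∀ᶠ M : ℕ in atTop, truncSlowness lam M K ω x = finSlowness lam K ω x := by
  induction K generalizing x with
  | zero => exact Eventually.of_forall fun _ => rfl
  | succ K ih =>
    filter_upwards [ih (x - 1),
      tendsto_natCast_atTop_atTop.eventually_ge_atTop (finSlowness lam (K + 1) ω x)] with M h1 h2
    simp only [truncSlowness, h1]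
    exact min_eq_right h2

theorem ofReal_finSlowness (lam : ℝ) (K : ℕ) (ω : Env) (x : ℤ) :
    ENNReal.ofReal (finSlowness lam K ω x) =
      ∑ k ∈ Finset.range K, (oddsProd lam k ω x + oddsProd lam (k + 1) ω x) := by
  induction K generalizing x with
  | zero => simp [finSlowness]
  | succ K ih =>
    have h1 := (odds_pos lam ω x).le
    have h2 := finSlowness_nonneg lam K ω (x - 1)
    rw [Finset.sum_range_succ', finSlowness, ENNReal.ofReal_add (by positivity) (by positivity),
      ENNReal.ofReal_mul h1, ih, ENNReal.ofReal_add zero_le_one h1, Finset.mul_sum, add_comm]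
    congr 1
    · refine Finset.sum_congr rfl fun k _ => ?_
      rw [oddsProd_succ lam (k + 1) ω x, oddsProd_succ lam k ω x, mul_add]
    · simp [oddsProd]

theorem slowness_eq_tsum (P : Measure Env) [IsProbabilityMeasure P] (lam : ℝ) :
    slowness P lam = ∑' k, (oddsMoment P lam k + oddsMoment P lam (k + 1)) := by
  rw [ENNReal.tsum_add, tsum_eq_zero_add' ENNReal.summable, oddsMoment_zero, slowness]
  ring

/-- The truncated slownesses approximate the slowness from below. -/
theorem exists_lt_lintegral_truncSlowness {P : Measure Env} [IsProbabilityMeasure P]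
    (hP : MeasurePreserving shift P P) {lam : ℝ} {c : ENNReal} (hc : c < slowness P lam) :
    ∃ M K : ℕ, c < ∫⁻ ω, ENNReal.ofReal (truncSlowness lam M K ω 0) ∂P := by
  rw [slowness_eq_tsum, ENNReal.tsum_eq_iSup_nat, lt_iSup_iff] at hc
  obtain ⟨K, hK⟩ := hc
  have e : ∫⁻ ω, ENNReal.ofReal (finSlowness lam K ω 0) ∂P
      = ∑ k ∈ Finset.range K, (oddsMoment P lam k + oddsMoment P lam (k + 1)) := by
    have hsum : ∀ k, Measurable fun ω => oddsProd lam k ω 0 + oddsProd lam (k + 1) ω 0 :=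
      fun k => (measurable_oddsProd lam k 0).add (measurable_oddsProd lam (k + 1) 0)
    simp_rw [ofReal_finSlowness]
    rw [lintegral_finsetSum _ fun k _ => hsum k]
    refine Finset.sum_congr rfl fun k _ => ?_
    rw [lintegral_add_left (measurable_oddsProd lam k 0), lintegral_oddsProd hP,
      lintegral_oddsProd hP]
  have hfatou : ∫⁻ ω, ENNReal.ofReal (finSlowness lam K ω 0) ∂P ≤
      liminf (fun M : ℕ => ∫⁻ ω, ENNReal.ofReal (truncSlowness lam M K ω 0) ∂P) atTop := by
    refine le_trans (lintegral_mono fun ω => ?_)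
      (lintegral_liminf_le fun M => (measurable_truncSlowness K 0).ennreal_ofReal)
    have : Tendsto (fun M : ℕ => ENNReal.ofReal (truncSlowness lam M K ω 0)) atTop
        (𝓝 (ENNReal.ofReal (finSlowness lam K ω 0))) :=
      tendsto_const_nhds.congr'
        ((eventually_truncSlowness_eq lam K ω 0).mono fun M h => by simp only [h])
    exact this.liminf_eq.ge
  obtain ⟨M, hM⟩ := (eventually_lt_of_lt_liminf ((hK.trans_eq e.symm).trans_le hfatou)).exists
  exact ⟨M, K, hM⟩

/-- The speed of the walk is at most the inverse of the slowness. -/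
theorem ae_eventually_le_mul {P : Measure Env} [IsProbabilityMeasure P] (hP : Ergodic shift P)
    {lam q : ℝ} (hq : 0 < q) (h : (ENNReal.ofReal q)⁻¹ < slowness P lam) :
    ∀ᵐ ω ∂P, ∀ᵐ X ∂(walkLaw lam ω), ∀ᶠ n : ℕ in atTop, (X n : ℝ) ≤ q * n := by
  obtain ⟨M, K, hMK⟩ := exists_lt_lintegral_truncSlowness hP.toMeasurePreserving h
  set D : Env → ℤ → ℝ := truncSlowness lam M K with hD
  have hM : (0 : ℝ) ≤ M := Nat.cast_nonneg M
  have hD0 : ∀ ω x, 0 ≤ D ω x := truncSlowness_nonneg hM K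
  have hDM : ∀ ω x, D ω x ≤ M := truncSlowness_le hM K
  have hDabs : ∀ ω x, |D ω x| ≤ M := fun ω x => by rw [abs_of_nonneg (hD0 ω x)]; exact hDM ω x
  have hDm : Measurable fun ω => D ω 0 := measurable_truncSlowness K 0
  set m := ∫ ω, D ω 0 ∂P with hm
  have hqm : 1 < q * m := by
    rw [← ofReal_integral_eq_lintegral_ofReal (integrable_of_abs_le hDm fun ω => hDabs ω 0)
      (ae_of_all _ fun ω => hD0 ω 0), ← ENNReal.ofReal_inv_of_pos hq,
      ENNReal.ofReal_lt_ofReal_iff_of_nonneg (inv_nonneg.2 hq.le),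
      inv_lt_iff_one_lt_mul₀' hq] at hMK
    exact hMK
  filter_upwards [tendsto_birkhoffAverage_of_ergodic hP hDm hM fun ω => hDabs ω 0] with ω hω
  obtain ⟨h, hstep, hnat⟩ := exists_int_primitive (D ω)
  have hlim : Tendsto (fun n : ℕ => h n / n) atTop (𝓝 m) := by
    refine hω.congr fun n => ?_
    rw [birkhoffAverage, birkhoffSum, hnat, smul_eq_mul, div_eq_inv_mul]
    congr 1
    refine Finset.sum_congr rfl fun k _ => ?_
    rw [shift_iterate, hD, truncSlowness_translate, zero_add]
  have hh0 : h 0 = 0 := by simpa using hnat 0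
  have hdrift : ∀ x, biasedPlus lam ω x * h (x + 1) + biasedMinus lam ω x * h (x - 1)
      ≤ h x + 1 := by
    intro x
    have h1 := hstep (x - 1)
    rw [sub_add_cancel] at h1
    have h2 := truncSlowness_drift (lam := lam) hM K ω x
    have h3 := biasedPlus_add_biasedMinus lam ω x
    have h4 : h (x - 1) = h x - D ω (x - 1) := by linarith
    have h5 : biasedMinus lam ω x = 1 - biasedPlus lam ω x := by linarith
    rw [hstep x, h4]
    rw [← hD] at h2
    rw [h5] at h2 ⊢
    linarith
  -- choose `m'` with `1 / q < m' < m`; then `h` grows along the walk at most at rate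
  -- `1 + ε` with `ε = q m' - 1`
  obtain ⟨m', hm'1, hm'2⟩ := exists_between ((div_lt_iff₀' hq).2 hqm)
  have hqm' : 0 < q * m' - 1 := by
    have := (div_lt_iff₀' hq).1 hm'1
    linarith
  have hm'0 : 0 < m' := lt_trans (by positivity) hm'1
  filter_upwards [ae_eventually_height_le hh0 (B := M)
    (fun x => by rw [hstep x, add_sub_cancel_left]; exact hDabs ω x) hdrift hqm'] with X hX
  obtain ⟨N, hN⟩ := eventually_atTop.1
    ((hlim.eventually (lt_mem_nhds hm'2)).and (eventually_gt_atTop 0))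
  filter_upwards [hX, tendsto_natCast_atTop_atTop.eventually_ge_atTop ((N : ℝ) / q)] with n hn1 hn2
  by_contra hlt
  push Not at hlt
  have hNn : (N : ℝ) ≤ q * n := (div_le_iff₀' hq).1 hn2
  have hXpos : (N : ℤ) < X n := by exact_mod_cast hNn.trans_lt hlt
  obtain ⟨k, hk⟩ : ∃ k : ℕ, X n = k := ⟨(X n).toNat, by omega⟩
  rw [hk] at hn1 hlt hXpos
  obtain ⟨h1, h2⟩ := hN k (by omega)
  have hk0 : (0 : ℝ) < k := by exact_mod_cast h2
  rw [lt_div_iff₀ hk0] at h1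
  have h3 : q * n < (k : ℝ) := by exact_mod_cast hlt
  have h4 := mul_lt_mul_of_pos_left h3 hm'0
  linarith

/-! ### The invariant measure of the environment seen from the walker -/

/-- The equilibrium flux `1 + ρ_1 + ρ_1 ρ_2 + ⋯` to the right at the origin, normalised so that the
net flux is `1`. -/
noncomputable def flux (lam : ℝ) (ω : Env) : ENNReal :=
  ∑' k, ∏ i ∈ Finset.range k, ENNReal.ofReal (odds lam ω ((i : ℤ) + 1))

theorem measurable_flux (lam : ℝ) : Measurable (flux lam) :=
  Measurable.tsum fun _ => Finset.measurable_prod _ fun _ _ =>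
    (measurable_odds _ _).ennreal_ofReal

theorem flux_eq (lam : ℝ) (ω : Env) :
    flux lam ω = 1 + ENNReal.ofReal (odds lam ω 1) * flux lam (translate 1 ω) := by
  rw [flux, tsum_eq_zero_add' ENNReal.summable, flux, ← ENNReal.tsum_mul_left]
  congr 1
  refine tsum_congr fun k => ?_
  rw [Finset.prod_range_succ', mul_comm]
  simp [odds_translate]

theorem flux_translate_neg_one (lam : ℝ) (ω : Env) :
    flux lam (translate (-1) ω) = 1 + ENNReal.ofReal (odds lam ω 0) * flux lam ω := by
  rw [flux_eq, translate_translate, odds_translate]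
  simp [translate_zero]

theorem lintegral_flux (P : Measure Env) [IsProbabilityMeasure P] (lam : ℝ) :
    ∫⁻ ω, flux lam ω ∂P = 1 + ∑' k, oddsMoment P lam (k + 1) := by
  have h : ∫⁻ ω, flux lam ω ∂P = ∑' k, oddsMoment P lam k := by
    unfold flux
    rw [lintegral_tsum]
    · rfl
    · exact fun _ => (Finset.measurable_prod _ fun _ _ =>
        (measurable_odds _ _).ennreal_ofReal).aemeasurable
  rw [h, tsum_eq_zero_add' ENNReal.summable, oddsMoment_zero]

variable {P : Measure Env}

theorem lintegral_odds_mul_flux [IsProbabilityMeasure P] (hP : MeasurePreserving shift P P)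
    (lam : ℝ) :
    ∫⁻ ω, ENNReal.ofReal (odds lam ω 0) * flux lam ω ∂P = ∑' k, oddsMoment P lam (k + 1) := by
  have h := lintegral_flux P lam
  rw [← (measurePreserving_translate_neg_one hP).lintegral_comp (measurable_flux lam)] at h
  simp_rw [flux_translate_neg_one] at h
  rw [lintegral_add_left measurable_const, lintegral_one, measure_univ] at h
  exact (ENNReal.add_right_inj ENNReal.one_ne_top).1 h

/-- The density, with respect to the law of the environment, of an invariant measure of the
environment seen from the walker: the flux to the right divided by `ω_0^+(λ)`, that is
`1 + ρ_0(λ)` times the flux. -/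
noncomputable def viewDensity (lam : ℝ) (ω : Env) : ENNReal :=
  flux lam ω + ENNReal.ofReal (odds lam ω 0) * flux lam ω

theorem measurable_viewDensity (lam : ℝ) : Measurable (viewDensity lam) :=
  (measurable_flux lam).add ((measurable_odds lam 0).ennreal_ofReal.mul (measurable_flux lam))

theorem one_le_viewDensity (lam : ℝ) (ω : Env) : 1 ≤ viewDensity lam ω := by
  rw [viewDensity, flux_eq, add_assoc]
  exact le_self_add

theorem lintegral_viewDensity [IsProbabilityMeasure P] (hP : MeasurePreserving shift P P)
    (lam : ℝ) : ∫⁻ ω, viewDensity lam ω ∂P = slowness P lam := by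
  unfold viewDensity
  rw [lintegral_add_left (measurable_flux lam), lintegral_flux, lintegral_odds_mul_flux hP,
    slowness]
  ring

theorem viewDensity_eq (lam : ℝ) (ω : Env) :
    viewDensity lam ω = ENNReal.ofReal (1 + odds lam ω 0) * flux lam ω := by
  rw [ENNReal.ofReal_add zero_le_one (odds_pos _ _ _).le, ENNReal.ofReal_one, add_mul, one_mul,
    viewDensity]

theorem viewDensity_mul_biasedPlus (lam : ℝ) (ω : Env) :
    viewDensity lam ω * ENNReal.ofReal (biasedPlus lam ω 0) = flux lam ω := by
  rw [viewDensity_eq, mul_comm, ← mul_assoc, ← ENNReal.ofReal_mul (biasedPlus_nonneg _ _ _),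
    biasedPlus_mul_one_add_odds, ENNReal.ofReal_one, one_mul]

theorem viewDensity_mul_biasedMinus (lam : ℝ) (ω : Env) :
    viewDensity lam ω * ENNReal.ofReal (biasedMinus lam ω 0)
      = ENNReal.ofReal (odds lam ω 0) * flux lam ω := by
  rw [← biasedPlus_mul_odds, ENNReal.ofReal_mul (biasedPlus_nonneg _ _ _), ← mul_assoc,
    viewDensity_mul_biasedPlus, mul_comm]

/-- The law of the environment with density `viewDensity` is invariant for the Markov chain of the
environment seen from the walker. -/
theorem lintegral_viewDensity_step (hP : MeasurePreserving shift P P) (lam : ℝ)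
    {φ : Env → ENNReal} (hφ : Measurable φ) :
    ∫⁻ ω, viewDensity lam ω * ∫⁻ y, φ (translate y ω) ∂(stepLaw lam ω 0) ∂P
      = ∫⁻ ω, viewDensity lam ω * φ ω ∂P := by
  have hf := measurable_flux lam
  have ho : ∀ x, Measurable fun ω => ENNReal.ofReal (odds lam ω x) :=
    fun x => (measurable_odds lam x).ennreal_ofReal
  have h1 : ∀ ω, viewDensity lam ω * ∫⁻ y, φ (translate y ω) ∂(stepLaw lam ω 0)
      = flux lam ω * φ (translate 1 ω)
        + ENNReal.ofReal (odds lam ω 0) * flux lam ω * φ (translate (-1) ω) := by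
    intro ω
    rw [lintegral_stepLaw lam ω 0 fun y => φ (translate y ω), mul_add, ← mul_assoc, ← mul_assoc,
      viewDensity_mul_biasedPlus, viewDensity_mul_biasedMinus, zero_add, zero_sub]
  have hm1 : Measurable fun ω => flux lam ω * φ (translate 1 ω) :=
    hf.mul (hφ.comp (measurable_translate 1))
  have hm2 : Measurable fun ω => flux lam (translate (-1) ω) * φ ω :=
    (hf.comp (measurable_translate (-1))).mul hφ
  have hm3 : Measurable fun ω =>
      ENNReal.ofReal (odds lam ω 0) * flux lam ω * φ (translate (-1) ω) :=
    ((ho 0).mul hf).mul (hφ.comp (measurable_translate (-1)))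
  -- the flux from the left
  have h2 : ∫⁻ ω, flux lam ω * φ (translate 1 ω) ∂P
      = ∫⁻ ω, flux lam (translate (-1) ω) * φ ω ∂P := by
    rw [← hP.lintegral_comp hm2]
    refine lintegral_congr fun ω => ?_
    simp only [← translate_one, translate_translate]
    simp [translate_zero]
  -- the flux from the right
  have h3 : ∫⁻ ω, ENNReal.ofReal (odds lam ω 0) * flux lam ω * φ (translate (-1) ω) ∂P
      = ∫⁻ ω, ENNReal.ofReal (odds lam ω 1) * flux lam (translate 1 ω) * φ ω ∂P := by
    rw [← hP.lintegral_comp hm3]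
    refine lintegral_congr fun ω => ?_
    simp only [← translate_one, translate_translate, odds_translate]
    simp [translate_zero]
  simp_rw [h1]
  rw [lintegral_add_left hm1, h2, h3, ← lintegral_add_left hm2]
  refine lintegral_congr fun ω => ?_
  rw [← add_mul, flux_translate_neg_one, viewDensity]
  congr 1
  conv_rhs => rw [add_comm]; arg 2; rw [flux_eq]
  ring

/-! ### The stationary process of walk and environment -/

/-- Restarting a path at time `1`, at the origin. -/
def restart (X : ℕ → ℤ) : ℕ → ℤ := fun n => X (n + 1) - X 1

theorem measurable_restart : Measurable restart :=
  measurable_pi_lambda _ fun n => (measurable_pi_apply (n + 1)).sub (measurable_pi_apply 1)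

theorem stepLaw_translate (lam : ℝ) (y : ℤ) (ω : Env) (x z : ℤ) :
    stepLaw lam (translate y ω) x {z} = stepLaw lam ω (x + y) {z + y} := by
  have e1 : z + y = x + y + 1 ↔ z = x + 1 := by constructor <;> intro h <;> linarith
  have e2 : z + y = x + y - 1 ↔ z = x - 1 := by constructor <;> intro h <;> linarith
  simp only [stepLaw_singleton, e1, e2]
  rfl

theorem measurableSet_apply_one_eq (y : ℤ) : MeasurableSet {X : ℕ → ℤ | X 1 = y} :=
  measurableSet_eq_fun (measurable_pi_apply 1) measurable_const

/-- The Markov property at time `1`. -/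
theorem map_restart_walkLaw (lam : ℝ) (ω : Env) (y : ℤ) :
    ((walkLaw lam ω).restrict {X | X 1 = y}).map restart
      = stepLaw lam ω 0 {y} • walkLaw lam (translate y ω) := by
  refine measure_path_ext fun n x => ?_
  rw [Measure.map_apply measurable_restart (measurableSet_pathCylinder _ _),
    Measure.restrict_apply (measurable_restart (measurableSet_pathCylinder _ _)),
    Measure.smul_apply, smul_eq_mul, walkLaw_pathCylinder]
  by_cases h0 : x 0 = 0
  · set x' : ℕ → ℤ := fun i => Nat.casesOn i 0 fun j => x j + y with hx'
    have hset : (restart ⁻¹' {X | ∀ i ≤ n, X i = x i} ∩ {X | X 1 = y} : Set (ℕ → ℤ))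
        =ᵐ[walkLaw lam ω] {X | ∀ i ≤ n + 1, X i = x' i} := by
      refine eventuallyEq_set.2 ?_
      filter_upwards [ae_walkLaw_zero lam ω] with X hX
      constructor
      · rintro ⟨h1, h2⟩ i hi
        cases i with
        | zero => exact hX
        | succ j =>
          have h3 : X (j + 1) - X 1 = x j := h1 j (by omega)
          have h4 : X 1 = y := h2
          change X (j + 1) = x j + y
          omega
      · intro h
        have h1 : X 1 = x 0 + y := h 1 (by omega)
        refine ⟨fun i hi => ?_, by change X 1 = y; omega⟩
        have h2 : X (i + 1) = x i + y := h (i + 1) (by omega)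
        change X (i + 1) - X 1 = x i
        omega
    rw [measure_congr hset, walkLaw_pathCylinder, if_pos (show x' 0 = 0 from rfl), one_mul,
      if_pos h0, one_mul,
      Finset.prod_range_succ', mul_comm]
    congr 1
    · change stepLaw lam ω 0 {x 0 + y} = _
      rw [h0, zero_add]
    · exact Finset.prod_congr rfl fun i _ => (stepLaw_translate lam y ω _ _).symm
  · rw [if_neg h0, zero_mul, mul_zero]
    refine measure_mono_null (fun X hX => h0 ?_) measure_empty
    have : X (0 + 1) - X 1 = x 0 := hX.1 0 (Nat.zero_le n)
    rw [← this]
    simp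

/-- One step of the walk, seen from the walker: the environment is translated along with the
walk. -/
def viewStep (p : Env × (ℕ → ℤ)) : Env × (ℕ → ℤ) := (translate (p.2 1) p.1, restart p.2)

theorem measurable_viewStep : Measurable viewStep := by
  refine Measurable.prodMk ?_ (measurable_restart.comp measurable_snd)
  have h : Measurable fun q : ℤ × Env => translate q.1 q.2 :=
    measurable_from_prod_countable_right fun y => measurable_translate y
  have h1 : Measurable fun p : Env × (ℕ → ℤ) => (p.2 1, p.1) :=
    ((measurable_pi_apply 1).comp measurable_snd).prodMk measurable_fst
  exact h.comp h1

/-- After one step the walk restarts in the translated environment. -/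
theorem lintegral_walkLaw_viewStep (lam : ℝ) (ω : Env) {F : Env × (ℕ → ℤ) → ENNReal}
    (hF : Measurable F) :
    ∫⁻ X, F (viewStep (ω, X)) ∂(walkLaw lam ω)
      = ∫⁻ y, ∫⁻ X, F (translate y ω, X) ∂(walkLaw lam (translate y ω)) ∂(stepLaw lam ω 0) := by
  have hU : ⋃ y : ℤ, {X : ℕ → ℤ | X 1 = y} = Set.univ := by
    ext X; simp
  rw [← setLIntegral_univ, ← hU, lintegral_iUnion measurableSet_apply_one_eq, lintegral_countable']
  · refine tsum_congr fun y => ?_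
    have hFy : Measurable fun X : ℕ → ℤ => F (translate y ω, X) :=
      hF.comp measurable_prodMk_left
    have h1 : ∫⁻ X in {X | X 1 = y}, F (viewStep (ω, X)) ∂(walkLaw lam ω)
        = ∫⁻ X in {X | X 1 = y}, F (translate y ω, restart X) ∂(walkLaw lam ω) := by
      refine setLIntegral_congr_fun (measurableSet_apply_one_eq y) fun X hX => ?_
      have : X 1 = y := hX
      simp only [viewStep, this]
    rw [h1, ← lintegral_map hFy measurable_restart, map_restart_walkLaw,
      lintegral_smul_measure, smul_eq_mul, mul_comm]
  · intro y z hyz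
    exact Set.disjoint_left.2 fun X h1 h2 => hyz (h1.symm.trans h2)

/-- The joint law of environment and walk, started from the invariant measure of the environment
seen from the walker. -/
noncomputable def viewMeasure (P : Measure Env) (lam : ℝ) : Measure (Env × (ℕ → ℤ)) :=
  (P.withDensity (viewDensity lam)) ⊗ₘ walkLawKernel lam

theorem isFiniteMeasure_withDensity_viewDensity [IsProbabilityMeasure P]
    (hP : MeasurePreserving shift P P) {lam : ℝ} (hS : slowness P lam ≠ ⊤) :
    IsFiniteMeasure (P.withDensity (viewDensity lam)) :=
  isFiniteMeasure_withDensity ((lintegral_viewDensity hP lam).trans_ne hS)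

theorem lintegral_viewMeasure [IsProbabilityMeasure P]
    (hP : MeasurePreserving shift P P) {lam : ℝ} (hS : slowness P lam ≠ ⊤)
    {F : Env × (ℕ → ℤ) → ENNReal} (hF : Measurable F) :
    ∫⁻ p, F p ∂(viewMeasure P lam)
      = ∫⁻ ω, viewDensity lam ω * ∫⁻ X, F (ω, X) ∂(walkLaw lam ω) ∂P := by
  have := isFiniteMeasure_withDensity_viewDensity hP hS
  rw [viewMeasure, Measure.lintegral_compProd hF,
    lintegral_withDensity_eq_lintegral_mul _ (measurable_viewDensity lam)]
  · rfl
  · exact hF.lintegral_kernel_prod_right'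

theorem measurePreserving_viewStep [IsProbabilityMeasure P]
    (hP : MeasurePreserving shift P P) {lam : ℝ} (hS : slowness P lam ≠ ⊤) :
    MeasurePreserving viewStep (viewMeasure P lam) (viewMeasure P lam) := by
  refine ⟨measurable_viewStep, Measure.ext_of_lintegral _ fun F hF => ?_⟩
  have hφ : Measurable fun ω => ∫⁻ X, F (ω, X) ∂(walkLaw lam ω) :=
    hF.lintegral_kernel_prod_right' (κ := walkLawKernel lam)
  have hFS : Measurable fun p => F (viewStep p) := hF.comp measurable_viewStep
  rw [lintegral_map hF measurable_viewStep, lintegral_viewMeasure hP hS hFS,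
    lintegral_viewMeasure hP hS hF,
    ← lintegral_viewDensity_step hP lam hφ]
  exact lintegral_congr fun ω => by rw [lintegral_walkLaw_viewStep lam ω hF]

/-- The first step of the walk, as a bounded function. -/
noncomputable def firstStep (p : Env × (ℕ → ℤ)) : ℝ := max (-1) (min 1 (p.2 1 : ℝ))

theorem measurable_firstStep : Measurable firstStep := by
  have h : Measurable fun y : ℤ => max (-1 : ℝ) (min 1 (y : ℝ)) := measurable_of_countable _
  exact h.comp ((measurable_pi_apply 1).comp measurable_snd)

theorem abs_firstStep_le (p : Env × (ℕ → ℤ)) : |firstStep p| ≤ 1 :=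
  abs_le.2 ⟨le_max_left _ _, max_le (by norm_num) (min_le_left _ _)⟩

theorem snd_viewStep_iterate (k : ℕ) (p : Env × (ℕ → ℤ)) (h0 : p.2 0 = 0) (n : ℕ) :
    (viewStep^[k] p).2 n = p.2 (n + k) - p.2 k := by
  induction k generalizing n with
  | zero => simp [h0]
  | succ k ih =>
    rw [Function.iterate_succ_apply']
    change (viewStep^[k] p).2 (n + 1) - (viewStep^[k] p).2 1 = _
    rw [ih, ih, show n + 1 + k = n + (k + 1) by omega, show 1 + k = k + 1 by omega]
    ring

theorem birkhoffSum_firstStep (ω : Env) {X : ℕ → ℤ} (h0 : X 0 = 0)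
    (hX : ∀ n, X (n + 1) = X n + 1 ∨ X (n + 1) = X n - 1) (n : ℕ) :
    birkhoffSum viewStep firstStep n (ω, X) = X n := by
  induction n with
  | zero => simp [h0]
  | succ n ih =>
    rw [birkhoffSum_succ, ih, firstStep, snd_viewStep_iterate n (ω, X) h0 1,
      show 1 + n = n + 1 by omega]
    rcases hX n with h | h <;> simp [h]; ring

theorem lintegral_viewMeasure_first [IsProbabilityMeasure P]
    (hP : MeasurePreserving shift P P) {lam : ℝ} (hS : slowness P lam ≠ ⊤) (u : ℤ → ENNReal) :
    ∫⁻ p, u (p.2 1) ∂(viewMeasure P lam)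
      = (∫⁻ ω, flux lam ω ∂P) * u 1
        + (∫⁻ ω, ENNReal.ofReal (odds lam ω 0) * flux lam ω ∂P) * u (-1) := by
  have hu : Measurable fun p : Env × (ℕ → ℤ) => u (p.2 1) :=
    (measurable_of_countable u).comp ((measurable_pi_apply 1).comp measurable_snd)
  have hf := measurable_flux lam
  have hof : Measurable fun ω => ENNReal.ofReal (odds lam ω 0) * flux lam ω :=
    (measurable_odds lam 0).ennreal_ofReal.mul hf
  rw [lintegral_viewMeasure hP hS hu, ← lintegral_mul_const _ hf, ← lintegral_mul_const _ hof,
    ← lintegral_add_left (hf.mul_const _)]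
  refine lintegral_congr fun ω => ?_
  have h := lintegral_walkLaw_pair lam ω 0 fun _ y => u y
  simp only [zero_add] at h
  rw [h, lintegral_congr_ae (g := fun _ => ENNReal.ofReal (biasedPlus lam ω 0) * u 1
    + ENNReal.ofReal (biasedMinus lam ω 0) * u (-1))]
  · rw [lintegral_const, measure_univ, mul_one, mul_add, ← mul_assoc, ← mul_assoc,
      viewDensity_mul_biasedPlus, viewDensity_mul_biasedMinus]
  · filter_upwards [ae_walkLaw_zero lam ω] with X hX
    simp [hX]

/-- The mean first step is the net flux, which is `1`: the joint law is not normalised. -/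
theorem integral_firstStep [IsProbabilityMeasure P]
    (hP : MeasurePreserving shift P P) {lam : ℝ} (hS : slowness P lam ≠ ⊤)
    [IsFiniteMeasure (viewMeasure P lam)] :
    ∫ p, firstStep p ∂(viewMeasure P lam) = 1 := by
  have hJ : ∑' k, oddsMoment P lam (k + 1) ≠ ⊤ := by
    intro h
    rw [slowness, h] at hS
    simp at hS
  rw [integral_eq_lintegral_pos_part_sub_lintegral_neg_part
    (integrable_of_abs_le measurable_firstStep abs_firstStep_le)]
  unfold firstStep
  rw [lintegral_viewMeasure_first hP hS fun y => ENNReal.ofReal (max (-1) (min 1 (y : ℝ))),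
    lintegral_viewMeasure_first hP hS fun y => ENNReal.ofReal (-max (-1) (min 1 (y : ℝ))),
    lintegral_flux, lintegral_odds_mul_flux hP]
  have e1 : ENNReal.ofReal (max (-1) (min 1 ((1 : ℤ) : ℝ))) = 1 := by norm_num
  have e2 : ENNReal.ofReal (max (-1) (min 1 ((-1 : ℤ) : ℝ))) = 0 := by norm_num
  have e3 : ENNReal.ofReal (-max (-1) (min 1 ((1 : ℤ) : ℝ))) = 0 := by norm_num
  have e4 : ENNReal.ofReal (-max (-1) (min 1 ((-1 : ℤ) : ℝ))) = 1 := by norm_num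
  rw [e1, e2, e3, e4, mul_one, mul_zero, mul_zero, mul_one, add_zero, zero_add,
    ENNReal.toReal_add ENNReal.one_ne_top hJ]
  simp

/-! ### The law of large numbers -/

theorem ae_eventually_le_add_mul [IsProbabilityMeasure P] (hP : Ergodic shift P) (lam : ℝ) :
    ∀ᵐ ω ∂P, ∀ᵐ X ∂(walkLaw lam ω), ∀ j : ℕ, ∀ᶠ n : ℕ in atTop,
      (X n : ℝ) ≤ ((slowness P lam)⁻¹.toReal + 1 / ((j : ℝ) + 1)) * n := by
  have h : ∀ j : ℕ, ∀ᵐ ω ∂P, ∀ᵐ X ∂(walkLaw lam ω), ∀ᶠ n : ℕ in atTop,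
      (X n : ℝ) ≤ ((slowness P lam)⁻¹.toReal + 1 / ((j : ℝ) + 1)) * n := by
    intro j
    have hj : (0 : ℝ) < 1 / ((j : ℝ) + 1) := by positivity
    refine ae_eventually_le_mul hP (by positivity) ?_
    have hfin : (slowness P lam)⁻¹ ≠ ⊤ :=
      ENNReal.inv_ne_top.2 (zero_lt_one.trans_le (one_le_slowness P lam)).ne'
    rw [ENNReal.inv_lt_iff_inv_lt, ENNReal.ofReal_add ENNReal.toReal_nonneg hj.le,
      ENNReal.ofReal_toReal hfin]
    exact ENNReal.lt_add_right hfin (ENNReal.ofReal_pos.2 hj).ne'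
  filter_upwards [ae_all_iff.2 h] with ω hω
  exact ae_all_iff.2 hω

/-- The law of large numbers when the walk has positive speed. -/
theorem hasVelocity_of_slowness_ne_top [IsProbabilityMeasure P] (hP : Ergodic shift P) {lam : ℝ}
    (hS : slowness P lam ≠ ⊤) : HasVelocity P lam (slowness P lam)⁻¹.toReal := by
  have hP' := hP.toMeasurePreserving
  have := isFiniteMeasure_withDensity_viewDensity hP' hS
  have hfin : IsFiniteMeasure (viewMeasure P lam) := by unfold viewMeasure; infer_instance
  set v := (slowness P lam)⁻¹.toReal with hv
  obtain ⟨h1, h2⟩ := tendsto_birkhoffAverage_ae (measurePreserving_viewStep hP' hS)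
    measurable_firstStep zero_le_one abs_firstStep_le
  have hVm : Measurable (upperAverage viewStep firstStep) :=
    measurable_upperAverage measurable_viewStep measurable_firstStep
  have hVi : Integrable (upperAverage viewStep firstStep) (viewMeasure P lam) :=
    integrable_of_abs_le hVm (abs_upperAverage_le zero_le_one abs_firstStep_le)
  have hlim : ∀ᵐ ω ∂(P.withDensity (viewDensity lam)), ∀ᵐ X ∂(walkLaw lam ω),
      Tendsto (fun n : ℕ => (X n : ℝ) / n) atTop
        (𝓝 (upperAverage viewStep firstStep (ω, X))) := by
    filter_upwards [Measure.ae_ae_of_ae_compProd h1] with ω hω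
    filter_upwards [hω, ae_walkLaw_zero lam ω, ae_walkLaw_succ lam ω] with X hX h0 hs
    refine hX.congr fun n => ?_
    rw [birkhoffAverage, birkhoffSum_firstStep ω h0 hs, smul_eq_mul, div_eq_inv_mul]
  have hle : ∀ᵐ p ∂(viewMeasure P lam), upperAverage viewStep firstStep p ≤ v := by
    refine Measure.ae_compProd_of_ae_ae (measurableSet_le hVm measurable_const) ?_
    filter_upwards [hlim, (withDensity_absolutelyContinuous P (viewDensity lam)).ae_le
      (ae_eventually_le_add_mul hP lam)] with ω hω1 hω2
    filter_upwards [hω1, hω2] with X hX1 hX2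
    have hj : ∀ j : ℕ, upperAverage viewStep firstStep (ω, X) ≤ v + 1 / ((j : ℝ) + 1) := by
      intro j
      refine le_of_tendsto hX1 ?_
      filter_upwards [hX2 j, eventually_gt_atTop 0] with n hn hn0
      have : (0 : ℝ) < n := by exact_mod_cast hn0
      rwa [div_le_iff₀ this]
    have hl : Tendsto (fun j : ℕ => v + 1 / ((j : ℝ) + 1)) atTop (𝓝 (v + 0)) :=
      tendsto_const_nhds.add tendsto_one_div_add_atTop_nhds_zero_nat
    rw [add_zero] at hl
    exact ge_of_tendsto' hl hj
  have hmass : (viewMeasure P lam).real Set.univ = (slowness P lam).toReal := by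
    rw [measureReal_def, ← lintegral_one, lintegral_viewMeasure hP' hS measurable_const,
      ← lintegral_viewDensity hP' lam]
    simp
  have heq : ∀ᵐ p ∂(viewMeasure P lam), upperAverage viewStep firstStep p = v := by
    have hint : ∫ p, (v - upperAverage viewStep firstStep p) ∂(viewMeasure P lam) = 0 := by
      rw [integral_sub (integrable_const v) hVi, h2, integral_firstStep hP' hS, integral_const,
        hmass, smul_eq_mul, hv, ENNReal.toReal_inv, mul_inv_cancel₀, sub_self]
      exact (ENNReal.toReal_pos (zero_lt_one.trans_le (one_le_slowness P lam)).ne' hS).ne'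
    rw [integral_eq_zero_iff_of_nonneg_ae] at hint
    · filter_upwards [hint] with p hp
      simp only [Pi.zero_apply] at hp
      linarith
    · filter_upwards [hle] with p hp
      exact sub_nonneg.2 hp
    · exact (integrable_const v).sub hVi
  have hac : P ≪ P.withDensity (viewDensity lam) :=
    withDensity_absolutelyContinuous' (measurable_viewDensity lam).aemeasurable
      (ae_of_all _ fun ω => (zero_lt_one.trans_le (one_le_viewDensity lam ω)).ne')
  refine hac.ae_le ?_
  filter_upwards [hlim, Measure.ae_ae_of_ae_compProd heq] with ω hω1 hω2
  have hω2' : ∀ᵐ X ∂(walkLaw lam ω), upperAverage viewStep firstStep (ω, X) = v := hω2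
  filter_upwards [hω1, hω2'] with X hX1 hX2
  rwa [hX2] at hX1

/-- If neither the walk nor its reflection has positive speed, the velocity is `0`. -/
theorem hasVelocity_zero [IsProbabilityMeasure P] (hP : Ergodic shift P) {lam : ℝ}
    (hS : slowness P lam = ⊤) (hS' : slowness (P.map reflect) (-lam) = ⊤) :
    HasVelocity P lam 0 := by
  have := isProbabilityMeasure_map_reflect (P := P)
  have h1 := ae_eventually_le_add_mul hP lam
  have h2 := ae_walkLaw_of_reflect (ae_eventually_le_add_mul (ergodic_map_reflect hP) (-lam))
  rw [hS] at h1
  rw [hS'] at h2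
  filter_upwards [h1, h2] with ω hω1 hω2
  filter_upwards [hω1, hω2] with X hX1 hX2
  rw [Metric.tendsto_atTop']
  intro ε hε
  obtain ⟨j, hj⟩ := exists_nat_one_div_lt hε
  obtain ⟨N, hN⟩ := eventually_atTop.1 ((hX1 j).and (hX2 j))
  refine ⟨N, fun n hn => ?_⟩
  obtain ⟨h3, h4⟩ := hN n hn.le
  have hn0 : (0 : ℝ) < n := by exact_mod_cast (Nat.zero_le N).trans_lt hn
  simp only [ENNReal.inv_top, ENNReal.toReal_zero, zero_add] at h3 h4
  push_cast at h4
  rw [Real.dist_eq, sub_zero]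
  refine lt_of_le_of_lt ?_ hj
  rw [abs_le]
  constructor
  · rw [le_div_iff₀ hn0]; linarith
  · rw [div_le_iff₀ hn0]; linarith

/-! ### The slowness as a function of the bias -/

section Bias

variable (P)

theorem oddsMoment_eq (lam : ℝ) (k : ℕ) :
    oddsMoment P lam k = oddsMoment P 0 k * ENNReal.ofReal (Real.exp (-2 * lam * k)) := by
  unfold oddsMoment
  rw [← lintegral_mul_const' _ _ ENNReal.ofReal_ne_top]
  refine lintegral_congr fun ω => ?_
  have h : ∀ i : ℕ, ENNReal.ofReal (odds lam ω ((i : ℤ) + 1))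
      = ENNReal.ofReal (odds 0 ω ((i : ℤ) + 1)) * ENNReal.ofReal (Real.exp (-2 * lam)) := by
    intro i
    rw [← ENNReal.ofReal_mul (odds_pos _ _ _).le]
    simp [odds]
  simp_rw [h]
  rw [Finset.prod_mul_distrib, Finset.prod_const, Finset.card_range,
    ← ENNReal.ofReal_pow (Real.exp_pos _).le, ← Real.exp_nat_mul, mul_comm (k : ℝ)]

theorem continuous_oddsMoment (k : ℕ) : Continuous fun lam => oddsMoment P lam k := by
  rw [funext fun lam => oddsMoment_eq P lam k]
  have hc : Continuous fun lam : ℝ => ENNReal.ofReal (Real.exp (-2 * lam * k)) :=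
    ENNReal.continuous_ofReal.comp (by fun_prop)
  by_cases h : oddsMoment P 0 k = ⊤
  · have : ∀ lam : ℝ, oddsMoment P 0 k * ENNReal.ofReal (Real.exp (-2 * lam * k)) = ⊤ := by
      intro lam
      rw [h, ENNReal.top_mul (ENNReal.ofReal_pos.2 (Real.exp_pos _)).ne']
    simp_rw [this]
    exact continuous_const
  · exact (ENNReal.continuous_const_mul h).comp hc

theorem antitone_oddsMoment (k : ℕ) : Antitone fun lam => oddsMoment P lam k := by
  intro lam lam' h
  change oddsMoment P lam' k ≤ oddsMoment P lam k
  rw [oddsMoment_eq P lam, oddsMoment_eq P lam']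
  have hk : (0 : ℝ) ≤ k := Nat.cast_nonneg k
  refine mul_le_mul_right (ENNReal.ofReal_le_ofReal (Real.exp_le_exp.2 ?_)) _
  nlinarith

theorem lowerSemicontinuous_tsum_oddsMoment :
    LowerSemicontinuous fun lam => ∑' k, oddsMoment P lam (k + 1) :=
  lowerSemicontinuous_tsum fun k => (continuous_oddsMoment P (k + 1)).lowerSemicontinuous

theorem slowness_ne_top_iff (lam : ℝ) :
    slowness P lam ≠ ⊤ ↔ ∑' k, oddsMoment P lam (k + 1) ≠ ⊤ := by
  rw [slowness]
  constructor
  · intro h h'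
    rw [h'] at h
    simp at h
  · intro h
    exact ENNReal.add_ne_top.2 ⟨ENNReal.one_ne_top, ENNReal.mul_ne_top (by simp) h⟩

/-- The slowness can only jump, as a function of the bias, at the left end of the set where it is
finite; when this set is open to the left, the inverse is continuous. -/
theorem continuous_inv_slowness
    (h : ∀ lam, slowness P lam ≠ ⊤ → ∃ lam' < lam, slowness P lam' ≠ ⊤) :
    Continuous fun lam => (slowness P lam)⁻¹ := by
  refine continuous_inv.comp (continuous_iff_continuousAt.2 fun lam => ?_)
  have hsum : ContinuousAt (fun lam => ∑' k, oddsMoment P lam (k + 1)) lam := by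
    by_cases hS : slowness P lam = ⊤
    · have hT : ∑' k, oddsMoment P lam (k + 1) = ⊤ := by
        by_contra hne
        exact (slowness_ne_top_iff P lam).2 hne hS
      rw [ContinuousAt, hT]
      refine tendsto_order.2 ⟨fun c hc => ?_, fun c hc => absurd hc not_top_lt⟩
      exact lowerSemicontinuous_tsum_oddsMoment P lam c (hc.trans_eq hT.symm)
    · obtain ⟨lam', hlt, hS'⟩ := h lam hS
      have hT' := (slowness_ne_top_iff P lam').1 hS'
      simp_rw [ContinuousAt, ← lintegral_count]
      refine tendsto_lintegral_filter_of_dominated_convergence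
        (fun k => oddsMoment P lam' (k + 1))
        (Eventually.of_forall fun _ => measurable_of_countable _)
        ?_ (by rwa [lintegral_count])
        (ae_of_all _ fun k => (continuous_oddsMoment P (k + 1)).tendsto lam)
      filter_upwards [lt_mem_nhds hlt] with x hx
      exact ae_of_all _ fun k => antitone_oddsMoment P (k + 1) hx.le
  exact tendsto_const_nhds.add (ENNReal.Tendsto.const_mul hsum (Or.inr (by simp)))

end Bias

/-! ### The slowness and the expectation of `log ρ` -/

theorem rho_pos (ω : Env) (x : ℤ) : 0 < rho ω x := div_pos (pMinus_pos ω x) (pPlus_pos ω x)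

theorem log_odds (lam : ℝ) (ω : Env) (x : ℤ) :
    Real.log (odds lam ω x) = Real.log (rho ω x) - 2 * lam := by
  rw [odds, Real.log_mul (rho_pos ω x).ne' (Real.exp_pos _).ne', Real.log_exp]
  ring

theorem measurable_log_rho (x : ℤ) : Measurable fun ω => Real.log (rho ω x) :=
  Real.measurable_log.comp (measurable_rho x)

theorem lintegral_ofReal_log_rho_ne_top [IsProbabilityMeasure P]
    (hP : MeasurePreserving shift P P) {lam : ℝ} (hS : slowness P lam ≠ ⊤) :
    ∫⁻ ω, ENNReal.ofReal (Real.log (rho ω 0)) ∂P ≠ ⊤ := by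
  have h1 : oddsMoment P lam 1 ≠ ⊤ :=
    ENNReal.ne_top_of_tsum_ne_top ((slowness_ne_top_iff P lam).1 hS) 0
  rw [← hP.lintegral_comp (measurable_log_rho 0).ennreal_ofReal]
  have hle : ∀ ω : Env, ENNReal.ofReal (Real.log (rho (shift ω) 0))
      ≤ ∏ i ∈ Finset.range 1, ENNReal.ofReal (odds lam ω ((i : ℤ) + 1))
        + ENNReal.ofReal (2 * |lam|) := by
    intro ω
    have e : rho (shift ω) 0 = rho ω 1 := rfl
    rw [Finset.prod_range_one, Nat.cast_zero, zero_add,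
      ← ENNReal.ofReal_add (odds_pos _ _ _).le (by positivity), e]
    refine ENNReal.ofReal_le_ofReal ?_
    have h2 := Real.log_le_sub_one_of_pos (odds_pos lam ω 1)
    rw [log_odds] at h2
    have := le_abs_self lam
    linarith
  refine ne_top_of_le_ne_top ?_ (lintegral_mono hle)
  rw [lintegral_add_right _ measurable_const, lintegral_const, measure_univ, mul_one]
  exact ENNReal.add_ne_top.2 ⟨h1, ENNReal.ofReal_ne_top⟩

theorem integrable_of_lintegral_ofReal {Ω : Type*} [MeasurableSpace Ω] {μ : Measure Ω} {f : Ω → ℝ}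
    (hf : Measurable f) (h1 : ∫⁻ ω, ENNReal.ofReal (f ω) ∂μ ≠ ⊤)
    (h2 : ∫⁻ ω, ENNReal.ofReal (-f ω) ∂μ ≠ ⊤) : Integrable f μ := by
  refine ⟨hf.aestronglyMeasurable, ?_⟩
  have e : ∀ ω, ‖f ω‖ₑ = ENNReal.ofReal (f ω) + ENNReal.ofReal (-f ω) := by
    intro ω
    rw [Real.enorm_eq_ofReal_abs]
    rcases le_total 0 (f ω) with h | h
    · rw [abs_of_nonneg h, ENNReal.ofReal_of_nonpos (neg_nonpos.2 h), add_zero]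
    · rw [abs_of_nonpos h, ENNReal.ofReal_of_nonpos h, zero_add]
  rw [HasFiniteIntegral]
  simp_rw [e]
  rw [lintegral_add_left hf.ennreal_ofReal]
  exact (ENNReal.add_ne_top.2 ⟨h1, h2⟩).lt_top

/-- If the slowness is finite, then some moment `E[ρ_1(λ) ⋯ ρ_k(λ)]` is less than `1`, and
`log y ≤ y - 1` gives `E[log ρ_0(λ)] < 0`. -/
theorem integral_log_rho_lt [IsProbabilityMeasure P] (hP : MeasurePreserving shift P P) {lam : ℝ}
    (hS : slowness P lam ≠ ⊤) (hint : Integrable (fun ω => Real.log (rho ω 0)) P) :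
    ∫ ω, Real.log (rho ω 0) ∂P < 2 * lam := by
  have hT := (slowness_ne_top_iff P lam).1 hS
  obtain ⟨k, hk⟩ : ∃ k, oddsMoment P lam (k + 1) < 1 := by
    by_contra hcon
    push Not at hcon
    refine hT (top_unique ?_)
    rw [← ENNReal.tsum_const_eq_top_of_ne_zero (α := ℕ) one_ne_zero]
    exact ENNReal.tsum_le_tsum hcon
  set Y : Env → ℝ := fun ω => ∏ i ∈ Finset.range (k + 1), odds lam ω ((i : ℤ) + 1) with hY
  have hYpos : ∀ ω, 0 < Y ω := fun ω => Finset.prod_pos fun i _ => odds_pos _ _ _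
  have hYm : Measurable Y := Finset.measurable_prod _ fun i _ => measurable_odds _ _
  have hYl : ∫⁻ ω, ENNReal.ofReal (Y ω) ∂P = oddsMoment P lam (k + 1) :=
    lintegral_congr fun ω => ENNReal.ofReal_prod_of_nonneg fun i _ => (odds_pos _ _ _).le
  have hYi : Integrable Y P := by
    refine integrable_of_lintegral_ofReal hYm (hYl.trans_ne hk.ne_top) ?_
    simp [fun ω => ENNReal.ofReal_of_nonpos (neg_nonpos.2 (hYpos ω).le)]
  have hY1 : ∫ ω, Y ω ∂P < 1 := by
    rw [integral_eq_lintegral_of_nonneg_ae (ae_of_all _ fun ω => (hYpos ω).le)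
      hYm.aestronglyMeasurable, hYl]
    exact (ENNReal.toReal_lt_toReal hk.ne_top ENNReal.one_ne_top).2 hk
  have hL : ∀ i : ℕ, Integrable (fun ω => Real.log (rho ω ((i : ℤ) + 1))) P ∧
      ∫ ω, Real.log (rho ω ((i : ℤ) + 1)) ∂P = ∫ ω, Real.log (rho ω 0) ∂P := by
    intro i
    have e : (fun ω : Env => Real.log (rho ω ((i : ℤ) + 1)))
        = fun ω => Real.log (rho (shift^[i + 1] ω) 0) := by
      funext ω
      rw [shift_iterate]
      simp [rho, pMinus, pPlus, translate]
    have hi := hP.iterate (i + 1)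
    rw [e]
    refine ⟨hi.integrable_comp_of_integrable hint, ?_⟩
    conv_rhs => rw [← hi.map_eq]
    rw [integral_map hi.aemeasurable (measurable_log_rho 0).aestronglyMeasurable]
  have hlog : ∀ ω, ∑ i ∈ Finset.range (k + 1), (Real.log (rho ω ((i : ℤ) + 1)) - 2 * lam)
      ≤ Y ω - 1 := by
    intro ω
    simp_rw [← log_odds]
    rw [← Real.log_prod fun i _ => (odds_pos lam ω _).ne']
    exact Real.log_le_sub_one_of_pos (hYpos ω)
  have hi' : ∀ i ∈ Finset.range (k + 1),
      Integrable (fun ω => Real.log (rho ω ((i : ℤ) + 1)) - 2 * lam) P :=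
    fun i _ => (hL i).1.sub (integrable_const (2 * lam))
  have hmono := integral_mono (integrable_finsetSum _ hi') (hYi.sub (integrable_const 1)) hlog
  simp only [Pi.sub_apply] at hmono
  rw [integral_finsetSum _ hi', integral_sub hYi (integrable_const 1)] at hmono
  have hterm : ∀ i ∈ Finset.range (k + 1),
      ∫ ω, (Real.log (rho ω ((i : ℤ) + 1)) - 2 * lam) ∂P
        = ∫ ω, Real.log (rho ω 0) ∂P - 2 * lam := by
    intro i _
    rw [integral_sub (hL i).1 (integrable_const _), (hL i).2]
    simp
  rw [Finset.sum_congr rfl hterm, Finset.sum_const, Finset.card_range, nsmul_eq_mul] at hmono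
  simp only [integral_const, probReal_univ, smul_eq_mul, mul_one] at hmono
  by_contra hcon
  push Not at hcon
  have h0 : 0 ≤ ((k + 1 : ℕ) : ℝ) * (∫ ω, Real.log (rho ω 0) ∂P - 2 * lam) :=
    mul_nonneg (Nat.cast_nonneg _) (by linarith)
  linarith

theorem integral_eq_toReal_sub {Ω : Type*} [MeasurableSpace Ω] {μ : Measure Ω} {f : Ω → ℝ}
    (hf : Integrable f μ) : ∫ ω, f ω ∂μ = (∫⁻ ω, ENNReal.ofReal (f ω) ∂μ).toReal
      - (∫⁻ ω, ENNReal.ofReal (-f ω) ∂μ).toReal :=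
  integral_eq_lintegral_pos_part_sub_lintegral_neg_part hf

theorem extExpectation_eq_integral {Ω : Type*} [MeasurableSpace Ω] {μ : Measure Ω} {f : Ω → ℝ}
    (hf : Integrable f μ) (h1 : ∫⁻ ω, ENNReal.ofReal (f ω) ∂μ ≠ ⊤)
    (h2 : ∫⁻ ω, ENNReal.ofReal (-f ω) ∂μ ≠ ⊤) :
    extExpectation μ f = ((∫ ω, f ω ∂μ : ℝ) : EReal) := by
  rw [extExpectation, integral_eq_toReal_sub hf, EReal.coe_sub, EReal.coe_ennreal_toReal h1,
    EReal.coe_ennreal_toReal h2]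

theorem extExpectation_div_two_lt [IsProbabilityMeasure P] (hP : MeasurePreserving shift P P)
    {lam : ℝ} (hS : slowness P lam ≠ ⊤) :
    extExpectation P (fun ω => Real.log (rho ω 0)) / 2 < lam := by
  have hA := lintegral_ofReal_log_rho_ne_top hP hS
  by_cases hB : ∫⁻ ω, ENNReal.ofReal (-Real.log (rho ω 0)) ∂P = ⊤
  · rw [extExpectation, hB, EReal.coe_ennreal_top, EReal.sub_top,
      EReal.bot_div_of_pos_ne_top two_pos (EReal.coe_ne_top 2)]
    exact EReal.bot_lt_coe lam
  · have hint := integrable_of_lintegral_ofReal (measurable_log_rho 0) hA hB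
    rw [extExpectation_eq_integral hint hA hB, show (2 : EReal) = ((2 : ℝ) : EReal) from rfl,
      ← EReal.coe_div, EReal.coe_lt_coe_iff]
    linarith [integral_log_rho_lt hP hS hint]

theorem log_rho_reflect (ω : Env) : Real.log (rho (reflect ω) 0) = -Real.log (rho ω 0) := by
  rw [← Real.log_inv, rho, rho, pPlus_reflect, pMinus_reflect, neg_zero, inv_div]

theorem lt_extExpectation_div_two [IsProbabilityMeasure P] (hP : Ergodic shift P)
    {lam : ℝ} (hS : slowness (P.map reflect) (-lam) ≠ ⊤) :
    (lam : EReal) < extExpectation P (fun ω => Real.log (rho ω 0)) / 2 := by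
  have := isProbabilityMeasure_map_reflect (P := P)
  have hP' := (ergodic_map_reflect hP).toMeasurePreserving
  have hB := lintegral_ofReal_log_rho_ne_top hP' hS
  have hm := measurable_log_rho 0
  rw [lintegral_map hm.ennreal_ofReal measurable_reflect] at hB
  simp_rw [log_rho_reflect] at hB
  by_cases hA : ∫⁻ ω, ENNReal.ofReal (Real.log (rho ω 0)) ∂P = ⊤
  · rw [extExpectation, hA, EReal.coe_ennreal_top, ← EReal.coe_ennreal_toReal hB,
      EReal.top_sub_coe, EReal.top_div_of_pos_ne_top two_pos (EReal.coe_ne_top 2)]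
    exact EReal.coe_lt_top lam
  · have hint := integrable_of_lintegral_ofReal hm hA hB
    have hint' : Integrable (fun ω => Real.log (rho ω 0)) (P.map reflect) := by
      rw [integrable_map_measure hm.aestronglyMeasurable measurable_reflect.aemeasurable]
      exact hint.neg.congr (ae_of_all _ fun ω => (log_rho_reflect ω).symm)
    have h := integral_log_rho_lt hP' hS hint'
    rw [integral_map measurable_reflect.aemeasurable hm.aestronglyMeasurable] at h
    simp_rw [log_rho_reflect] at h
    rw [integral_neg] at h
    rw [extExpectation_eq_integral hint hA hB, show (2 : EReal) = ((2 : ℝ) : EReal) from rfl,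
      ← EReal.coe_div, EReal.coe_lt_coe_iff]
    linarith

/-! ### The velocity -/

section velocity

theorem toReal_inv_slowness_pos {lam : ℝ} (hS : slowness P lam ≠ ⊤) :
    0 < (slowness P lam)⁻¹.toReal :=
  ENNReal.toReal_pos (ENNReal.inv_ne_zero.2 hS)
    (ENNReal.inv_ne_top.2 (zero_lt_one.trans_le (one_le_slowness P lam)).ne')

variable [IsProbabilityMeasure P] {lam : ℝ}

theorem hasVelocity_of_slowness_reflect_ne_top (hP : Ergodic shift P)
    (hS : slowness (P.map reflect) (-lam) ≠ ⊤) :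
    HasVelocity P lam (-(slowness (P.map reflect) (-lam))⁻¹.toReal) :=
  have := isProbabilityMeasure_map_reflect (P := P)
  (hasVelocity_of_slowness_ne_top (ergodic_map_reflect hP) hS).of_reflect

/-- The walk cannot have positive speed in both directions, as its velocity is unique. -/
theorem slowness_reflect_eq_top (hP : Ergodic shift P) (hS : slowness P lam ≠ ⊤) :
    slowness (P.map reflect) (-lam) = ⊤ := by
  by_contra hS'
  have h := (hasVelocity_of_slowness_ne_top hP hS).unique
    (hasVelocity_of_slowness_reflect_ne_top hP hS')
  linarith [toReal_inv_slowness_pos hS, toReal_inv_slowness_pos hS']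

/-- The law of large numbers. At most one of the two terms of the velocity is not zero. -/
theorem hasVelocity_inv_slowness (hP : Ergodic shift P) (lam : ℝ) :
    HasVelocity P lam ((slowness P lam)⁻¹.toReal
      - (slowness (P.map reflect) (-lam))⁻¹.toReal) := by
  by_cases hS : slowness P lam = ⊤
  · by_cases hS' : slowness (P.map reflect) (-lam) = ⊤
    · simpa [hS, hS'] using hasVelocity_zero hP hS hS'
    · simpa [hS] using hasVelocity_of_slowness_reflect_ne_top hP hS'
  · simpa [slowness_reflect_eq_top hP hS] using hasVelocity_of_slowness_ne_top hP hS

theorem velocity_eq (hP : Ergodic shift P) (lam : ℝ) :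
    velocity P lam = (slowness P lam)⁻¹.toReal
      - (slowness (P.map reflect) (-lam))⁻¹.toReal :=
  (hasVelocity_inv_slowness hP lam).velocity_eq

theorem velocity_pos_iff (hP : Ergodic shift P) : 0 < velocity P lam ↔ slowness P lam ≠ ⊤ := by
  rw [velocity_eq hP]
  refine ⟨fun h hS => ?_, fun hS => ?_⟩
  · rw [hS, ENNReal.inv_top, ENNReal.toReal_zero, zero_sub] at h
    linarith [ENNReal.toReal_nonneg (a := (slowness (P.map reflect) (-lam))⁻¹)]
  · rw [slowness_reflect_eq_top hP hS, ENNReal.inv_top, ENNReal.toReal_zero, sub_zero]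
    exact toReal_inv_slowness_pos hS

theorem velocity_neg_iff (hP : Ergodic shift P) :
    velocity P lam < 0 ↔ slowness (P.map reflect) (-lam) ≠ ⊤ := by
  refine ⟨fun h hS => ?_, fun hS => ?_⟩
  · rw [velocity_eq hP, hS, ENNReal.inv_top, ENNReal.toReal_zero, sub_zero] at h
    linarith [ENNReal.toReal_nonneg (a := (slowness P lam)⁻¹)]
  · rw [(hasVelocity_of_slowness_reflect_ne_top hP hS).velocity_eq]
    exact neg_lt_zero.2 (toReal_inv_slowness_pos hS)

theorem lamMinus_le (hP : Ergodic shift P) :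
    lamMinus P ≤ extExpectation P (fun ω => Real.log (rho ω 0)) / 2 := by
  refine sSup_le ?_
  rintro _ ⟨lam, hlam, rfl⟩
  exact (lt_extExpectation_div_two hP ((velocity_neg_iff hP).1 hlam)).le

theorem le_lamPlus (hP : Ergodic shift P) :
    extExpectation P (fun ω => Real.log (rho ω 0)) / 2 ≤ lamPlus P := by
  refine le_sInf ?_
  rintro _ ⟨lam, hlam, rfl⟩
  exact (extExpectation_div_two_lt hP.toMeasurePreserving ((velocity_pos_iff hP).1 hlam)).le

theorem continuous_toReal_inv_slowness (Q : Measure Env)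
    (h : ∀ lam, slowness Q lam ≠ ⊤ → ∃ lam' < lam, slowness Q lam' ≠ ⊤) :
    Continuous fun lam => (slowness Q lam)⁻¹.toReal :=
  ENNReal.continuousOn_toReal.comp_continuous (continuous_inv_slowness Q h) fun lam =>
    ENNReal.inv_ne_top.2 (zero_lt_one.trans_le (one_le_slowness Q lam)).ne'

end velocity

end RWRE

theorem proposition3p5 (P : Measure RWRE.Env) [IsProbabilityMeasure P]
    (hergodic : Ergodic RWRE.shift P)
    (hlog : RWRE.ExpectationDefined P (fun ω => Real.log (RWRE.rho ω 0))) :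
    (∀ lam : ℝ, RWRE.HasVelocity P lam (RWRE.velocity P lam)) ∧
    (RWRE.lamMinus P = RWRE.lamPlus P →
      Continuous (RWRE.velocity P) ∧
      RWRE.lamMinus P = RWRE.extExpectation P (fun ω => Real.log (RWRE.rho ω 0)) / 2 ∧
      RWRE.lamPlus P = RWRE.extExpectation P (fun ω => Real.log (RWRE.rho ω 0)) / 2 ∧
      (∀ lam : ℝ, (lam : EReal) = RWRE.lamMinus P → RWRE.velocity P lam = 0) ∧
      (∀ lam : ℝ, (lam : EReal) = RWRE.lamPlus P → RWRE.velocity P lam = 0)) := by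
  refine ⟨fun lam => ?_, fun heq => ?_⟩
  · rw [RWRE.velocity_eq hergodic]
    exact RWRE.hasVelocity_inv_slowness hergodic lam
  have hle := RWRE.lamMinus_le hergodic
  have hge := RWRE.le_lamPlus hergodic
  have hminus : RWRE.lamMinus P
      = RWRE.extExpectation P (fun ω => Real.log (RWRE.rho ω 0)) / 2 :=
    le_antisymm hle (heq ▸ hge)
  have hplus : RWRE.lamPlus P
      = RWRE.extExpectation P (fun ω => Real.log (RWRE.rho ω 0)) / 2 := heq ▸ hminus
  have hzero : ∀ lam : ℝ, (lam : EReal) = RWRE.lamMinus P → RWRE.velocity P lam = 0 := by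
    intro lam hlam
    rw [hminus] at hlam
    rcases lt_trichotomy (RWRE.velocity P lam) 0 with h | h | h
    · exact absurd hlam (RWRE.lt_extExpectation_div_two hergodic
        ((RWRE.velocity_neg_iff hergodic).1 h)).ne
    · exact h
    · exact absurd hlam (RWRE.extExpectation_div_two_lt hergodic.toMeasurePreserving
        ((RWRE.velocity_pos_iff hergodic).1 h)).ne'
  refine ⟨?_, hminus, hplus, hzero, fun lam hlam => hzero lam (hlam.trans heq.symm)⟩
  have h1 : Continuous fun lam => (RWRE.slowness P lam)⁻¹.toReal := by
    refine RWRE.continuous_toReal_inv_slowness P fun lam hS => ?_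
    have hlt := RWRE.extExpectation_div_two_lt hergodic.toMeasurePreserving hS
    rw [← hplus, RWRE.lamPlus, sInf_lt_iff] at hlt
    obtain ⟨_, ⟨lam', h, rfl⟩, hlt⟩ := hlt
    exact ⟨lam', EReal.coe_lt_coe_iff.1 hlt, (RWRE.velocity_pos_iff hergodic).1 h⟩
  have h2 : Continuous fun lam => (RWRE.slowness (P.map RWRE.reflect) lam)⁻¹.toReal := by
    refine RWRE.continuous_toReal_inv_slowness _ fun lam hS => ?_
    have hlt := RWRE.lt_extExpectation_div_two hergodic (lam := -lam) (by rwa [neg_neg])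
    rw [← hminus, RWRE.lamMinus, lt_sSup_iff] at hlt
    obtain ⟨_, ⟨lam', h, rfl⟩, hlt⟩ := hlt
    exact ⟨-lam', by linarith [EReal.coe_lt_coe_iff.1 hlt], (RWRE.velocity_neg_iff hergodic).1 h⟩
  have he : RWRE.velocity P = fun lam => (RWRE.slowness P lam)⁻¹.toReal
      - (RWRE.slowness (P.map RWRE.reflect) (-lam))⁻¹.toReal :=
    funext fun lam => RWRE.velocity_eq hergodic lam
  rw [he]
  exact h1.sub (h2.comp continuous_neg)
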